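/- Fix $k\ge 0$. A $k$-colored linear ordering is a linear ordering (possibly empty) each of whose points has exactly one of $k$ colors, viewed as a structure with a binary relation $<$ and $k$ unary color predicates. It is homogeneous if every isomorphism between finite (equivalently, finitely generated) substructures extends to an automorphism. Let $L(k)$ be the number of countable homogeneous $k$-colored linear orderings, up to isomorphism. Let $W$ be the principal branch of the product logarithm (the inverse of $w\mapsto we^w$ on $[-1,\infty)$). Then: 1. $L(k)$ is finite and equals the number (also finite), up to isomorphism, of linear orderings $(A,<)$ with unary predicates $R_1,\dots,R_k,S_1,\dots,S_k$ such that every point satisfies some $R_i$ or some $S_i$; no point satisfies two different $R_i$, and no point satisfies both some $R_i$ and some $S_j$; each $R_i$ and each $S_i$ holds of at most one point; and for each $i$, $R_i$ and $S_i$ do not both occur in $A$. 2. Let $J(0)=1$ and $J(k+1)=2(k+1)J(k)+\sum_{i=2}^{k+1}\binom{k+1}{i}J(k+1-i)$. Then $L(k)=\sum_{i=0}^{k}J(i)\binom{k}{i}$. 3. The exponential generating function of $L$ is $\sum_{k\ge 0}L(k)\frac{x^k}{k!}=H(x)=\frac{e^x}{2-x-e^x}$. 4. Put $Z=2-W(e^2)\approx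 0.442854$ and $R=\frac{-e^2}{e^{W(e^2)}+e^2}\approx -0.6089389$. Then $\lim_{z\to Z}(z-Z)H(z)=R$, so that $R$ is the residue of $H$ at its simple pole $Z$, and $L(k)\sim -k!\,R\,\left(\frac1Z\right)^{k+1}$ as $k\to\infty$. 5. As $k\to\infty$, the proportion of countable homogeneous $k$-colored linear orderings (up to isomorphism) in which all $k$ colors occur tends to $\frac{1}{W(e^2)}\approx 0.6422007$. Here $\approx$ means: with error less than $10^{-6}$ for $Z$ and less than $10^{-7}$ for $R$ and $1/W(e^2)$. -/

import Mathlib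

open FirstOrder.Language CategoryTheory Filter Topology
open scoped Nat

/-- Relation symbols of `k`-colored orderings: a binary `<` and `k` unary color predicates. -/
inductive ColoredOrderRel (k : ℕ) : ℕ → Type
  | lt : ColoredOrderRel k 2
  | color (i : Fin k) : ColoredOrderRel k 1

/-- The relational language of `k`-colored orderings. -/
def coloredOrderLang (k : ℕ) : FirstOrder.Language.{0, 0} := ⟨fun _ => Empty, ColoredOrderRel k⟩

/-- The structure `M` is a linear ordering in which every point has exactly one of the
`k` colors. -/
structure IsColoredLinearOrder (k : ℕ) (M : Type) [(coloredOrderLang k).Structure M] : Prop where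
  linear : IsStrictTotalOrder M fun x y =>
    Structure.RelMap (L := coloredOrderLang k) ColoredOrderRel.lt ![x, y]
  color : ∀ x : M, ∃! i : Fin k,
    Structure.RelMap (L := coloredOrderLang k) (ColoredOrderRel.color i) ![x]

/-- The countable homogeneous `k`-colored linear orderings (the empty one is allowed). -/
def homogeneousColoredOrders (k : ℕ) : Set (Bundled.{0} (coloredOrderLang k).Structure) :=
  {M | Countable M ∧ IsColoredLinearOrder k M ∧ (coloredOrderLang k).IsUltrahomogeneous M}

/-- The countable homogeneous `k`-colored linear orderings in which every color occurs. -/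
def homogeneousAllColors (k : ℕ) : Set (Bundled.{0} (coloredOrderLang k).Structure) :=
  {M | M ∈ homogeneousColoredOrders k ∧ ∀ i : Fin k, ∃ x : M,
    Structure.RelMap (L := coloredOrderLang k) (ColoredOrderRel.color i) ![x]}

/-- Relation symbols of multicolored orderings: a binary `<` and unary `R i`, `S i`. -/
inductive MultiColoredRel (k : ℕ) : ℕ → Type
  | lt : MultiColoredRel k 2
  | R (i : Fin k) : MultiColoredRel k 1
  | S (i : Fin k) : MultiColoredRel k 1

/-- The relational language of multicolored orderings. -/
def multiColoredLang (k : ℕ) : FirstOrder.Language.{0, 0} := ⟨fun _ => Empty, MultiColoredRel k⟩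

/-- The predicate `R i` of a multicolored ordering. -/
def predR {k : ℕ} {M : Type} [(multiColoredLang k).Structure M] (i : Fin k) (x : M) : Prop :=
  Structure.RelMap (L := multiColoredLang k) (MultiColoredRel.R i) ![x]

/-- The predicate `S i` of a multicolored ordering. -/
def predS {k : ℕ} {M : Type} [(multiColoredLang k).Structure M] (i : Fin k) (x : M) : Prop :=
  Structure.RelMap (L := multiColoredLang k) (MultiColoredRel.S i) ![x]

/-- The axioms of multicolored linear orderings, without any restriction on which points
may be adjacent. -/
structure IsMultiColoredOrder (k : ℕ) (M : Type) [(multiColoredLang k).Structure M] : Prop where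
  linear : IsStrictTotalOrder M fun x y =>
    Structure.RelMap (L := multiColoredLang k) MultiColoredRel.lt ![x, y]
  exists_color : ∀ x : M, ∃ i : Fin k, predR i x ∨ predS i x
  not_R_R : ∀ (x : M) (i j : Fin k), i ≠ j → ¬ (predR i x ∧ predR j x)
  not_R_S : ∀ (x : M) (i j : Fin k), ¬ (predR i x ∧ predS j x)
  R_unique : ∀ (i : Fin k) (x y : M), predR i x → predR i y → x = y
  S_unique : ∀ (i : Fin k) (x y : M), predS i x → predS i y → x = y
  R_S_disjoint : ∀ (i : Fin k) (x y : M), ¬ (predR i x ∧ predS i y)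

/-- The multicolored linear orderings with labels `R i`, `S i` for `i : Fin k`. -/
def multiColoredOrders (k : ℕ) : Set (Bundled.{0} (multiColoredLang k).Structure) :=
  {M | IsMultiColoredOrder k M}

/-- The isomorphism types of the members of a class of structures. -/
def isoTypes {L : FirstOrder.Language.{0, 0}} (K : Set (Bundled.{0} L.Structure)) :
    Set (Quotient (equivSetoid (L := L))) :=
  Quotient.mk equivSetoid '' K

/-- The number of homogeneous linear orderings in `k` colors, up to isomorphism. -/
noncomputable def numHomogeneous (k : ℕ) : ℕ := (isoTypes (homogeneousColoredOrders k)).ncard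

/-- The number of those that use all `k` colors. -/
noncomputable def numHomogeneousAll (k : ℕ) : ℕ := (isoTypes (homogeneousAllColors k)).ncard

/-- The principal branch of the product logarithm: the inverse of `w ↦ w * exp w`
on `[-1, ∞)`. -/
noncomputable def lambertW : ℝ → ℝ :=
  Function.invFunOn (fun w : ℝ => w * Real.exp w) (Set.Ici (-1))

/-- `Z = 2 - W(e²)`. -/
noncomputable def dominantPole : ℝ := 2 - lambertW (Real.exp 2)

/-- `R = -e² / (e^{W(e²)} + e²)`. -/
noncomputable def poleResidue : ℝ :=
  -Real.exp 2 / (Real.exp (lambertW (Real.exp 2)) + Real.exp 2)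

/-! Both classes of structures are classified by the same finite data, a `ColorPattern` satisfying
`IsWeakOrder`. In a homogeneous colored ordering, say that color i comes before color j if every
point of color i lies below every point of color j. Moving points by automorphisms shows that this
is a strict weak order on the used colors (`colPattern_isWeakOrder`). Its incomparability classes
are consecutive blocks. A block is either a single point, which has one color, or a block without
endpoints in which each of its colors is dense (`isGenericColored`). Back-and-forth shows that the
pattern determines a countable ordering of this kind and that every such ordering is homogeneous;
labelled rationals realize every pattern (`GenericOrder`). In a multicolored ordering each point
stands for a block: `R i` marks a singleton block of color i, and the labels `S j` at a point are
the colors of a dense block.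

Counting: a pattern on a nonempty set of colors is a first block followed by a pattern on the
remaining colors. One color can form a block in two ways, two or more colors in one way. This gives
the recursion for J, with generating function 1/(2 - x - e^x); choosing the set of used colors
multiplies it by e^x.

Asymptotics: e^Z = 2 - Z, so the block weights scaled by Z^n/n! form a probability distribution, and
J(n) Z^n/n! is its renewal sequence. Its mean Z(3 - Z) is less than 2, where an elementary renewal
theorem (`tendsto_renewal`) gives the limit without complex analysis. The asymptotics of L and the
limiting proportion 1/(2 - Z) = 1/W(e²) follow. -/

open scoped FirstOrder

/-! ### Counting weak-order patterns by their first block -/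

/-- The combinatorial shape of an ordering whose points carry colors from `α`: which colors are
used, which of them mark a single isolated point, and which colors lie entirely before others. -/
@[ext]
structure ColorPattern (α : Type*) where
  /-- the color occurs -/
  used : α → Prop
  /-- the color marks a singleton block -/
  single : α → Prop
  /-- the block of the first color lies before the block of the second -/
  before : α → α → Prop

namespace ColorPattern

variable {α : Type*}

/-- The used colors are strictly weakly ordered by `before`, and a color marking a singleton
is comparable with all others. -/
structure IsWeakOrder (p : ColorPattern α) : Prop where
  used_of_single : ∀ i, p.single i → p.used i
  used_left : ∀ i j, p.before i j → p.used i
  used_right : ∀ i j, p.before i j → p.used j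
  irrefl : ∀ i, ¬ p.before i i
  trans : ∀ i j l, p.before i j → p.before j l → p.before i l
  weak : ∀ i j l, p.before i j → p.used l → p.before i l ∨ p.before l j
  single_comparable : ∀ i j, p.single i → p.used j → j ≠ i → p.before i j ∨ p.before j i

/-- Put a new first block `B` in front of a pattern; `s` tells whether it is a singleton block. -/
def prepend (B : Finset α) (s : Prop) (p : ColorPattern α) : ColorPattern α where
  used i := i ∈ B ∨ p.used i
  single i := (i ∈ B ∧ s) ∨ p.single i
  before i j := (i ∈ B ∧ p.used j) ∨ p.before i j

/-- The weak-order patterns with set of used colors `U`. -/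
def patternsOn (U : Finset α) : Set (ColorPattern α) :=
  {p | p.IsWeakOrder ∧ ∀ i, p.used i ↔ i ∈ U}

/-- The possible first blocks of a pattern on `U`. -/
def firstBlocks (U : Finset α) : Finset (Finset α × Bool) :=
  (U.powerset ×ˢ Finset.univ).filter fun b => b.1.Nonempty ∧ (b.2 = true → b.1.card = 1)

theorem mem_firstBlocks {U : Finset α} {b : Finset α × Bool} :
    b ∈ firstBlocks U ↔ b.1 ⊆ U ∧ b.1.Nonempty ∧ (b.2 = true → b.1.card = 1) := by
  simp [firstBlocks]

/-- The number of kinds of blocks with a given number of colors: a single color may form a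
singleton block or a dense block. -/
def blockWeight : ℕ → ℕ
  | 0 => 0
  | 1 => 2
  | _ + 2 => 1

theorem sum_firstBlocks (U : Finset α) (f : ℕ → ℕ) :
    ∑ b ∈ firstBlocks U, f b.1.card =
      ∑ m ∈ Finset.range (U.card + 1), U.card.choose m * (blockWeight m * f m) := by
  have h := Finset.sum_powerset_apply_card (fun m => blockWeight m * f m) (x := U)
  simp only [smul_eq_mul] at h
  rw [← h, firstBlocks, Finset.sum_filter, Finset.sum_product]
  refine Finset.sum_congr rfl fun B _ => ?_
  rw [Fintype.sum_bool]
  obtain ⟨n, hB⟩ : ∃ n, B.card = n := ⟨_, rfl⟩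
  rcases n with _ | _ | n
  · simp [Finset.card_eq_zero.1 hB, blockWeight]
  · have : B.Nonempty := Finset.card_pos.1 (by omega)
    simp [this, hB, blockWeight, two_mul]
  · have : B.Nonempty := Finset.card_pos.1 (by omega)
    simp [this, hB, blockWeight]

variable [DecidableEq α]

theorem prepend_mem_patternsOn {U : Finset α} {b : Finset α × Bool} (hb : b ∈ firstBlocks U)
    {p : ColorPattern α} (hp : p ∈ patternsOn (U \ b.1)) :
    prepend b.1 (b.2 = true) p ∈ patternsOn U := by
  obtain ⟨hsub, hne, hcard⟩ := mem_firstBlocks.1 hb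
  obtain ⟨⟨h1, h2, h3, h4, h5, h6, h7⟩, hU⟩ := hp
  simp only [Finset.mem_sdiff] at hU
  refine ⟨⟨?_, ?_, ?_, ?_, ?_, ?_, ?_⟩, ?_⟩ <;> simp only [prepend]
  · grind
  · grind
  · grind
  · grind
  · grind
  · grind
  · rintro i j (⟨hi, hs⟩ | hi) hj hji
    · obtain ⟨a, ha⟩ := Finset.card_eq_one.1 (hcard hs)
      have hmem : ∀ x, x ∈ b.1 ↔ x = a := by simp [ha]
      grind
    · grind
  · intro i
    have := @hsub i
    grind

/-- The first block can be read off as the set of used colors with no predecessor, its flag from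
`single` at any of its elements, and the rest by restriction to the other colors. -/
theorem prepend_injective {U : Finset α} {b b' : Finset α × Bool} (hb : b ∈ firstBlocks U)
    (hb' : b' ∈ firstBlocks U) {p p' : ColorPattern α} (hp : p ∈ patternsOn (U \ b.1))
    (hp' : p' ∈ patternsOn (U \ b'.1))
    (h : prepend b.1 (b.2 = true) p = prepend b'.1 (b'.2 = true) p') : b = b' ∧ p = p' := by
  obtain ⟨hsub, ⟨a, ha⟩, -⟩ := mem_firstBlocks.1 hb
  obtain ⟨hsub', ⟨a', ha'⟩, -⟩ := mem_firstBlocks.1 hb'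
  obtain ⟨⟨h1, h2, h3, h4, h5, h6, h7⟩, hU⟩ := hp
  obtain ⟨⟨h1', h2', h3', h4', h5', h6', h7'⟩, hU'⟩ := hp'
  simp only [Finset.mem_sdiff] at hU hU'
  simp only [prepend, ColorPattern.mk.injEq, funext_iff, eq_iff_iff] at h
  obtain ⟨hu, hs, hbef⟩ := h
  have hB : b.1 = b'.1 := by
    ext i
    have := @hsub i
    have := @hsub' i
    have := hbef a i
    have := hbef a' i
    grind
  have hS : b.2 = b'.2 := by
    have := hs a
    have : b.2 = true ↔ b'.2 = true := by grind
    exact Bool.eq_iff_iff.2 this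
  refine ⟨Prod.ext hB hS, ?_⟩
  ext i j
  · grind
  · have := hs i
    grind
  · have := hbef i j
    grind

/-- The colors without predecessor form the first block. Weakness of the order puts them before all
the others, and a singleton color among them is alone because it is comparable with every other used
color. -/
theorem exists_eq_prepend {U : Finset α} (hU : U.Nonempty) {p : ColorPattern α}
    (hp : p ∈ patternsOn U) : ∃ b ∈ firstBlocks U, ∃ q ∈ patternsOn (U \ b.1),
      prepend b.1 (b.2 = true) q = p := by
  classical
  obtain ⟨⟨h1, h2, h3, h4, h5, h6, h7⟩, hpU⟩ := hp
  let B := U.filter fun i => ∀ j, ¬ p.before j i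
  have hBmem : ∀ i, i ∈ B ↔ i ∈ U ∧ ∀ j, ¬ p.before j i := by simp [B]
  have hmin : ∀ i ∈ U, ∃ a ∈ B, a = i ∨ p.before a i := by
    intro i hi
    let T := U.filter fun j => j = i ∨ p.before j i
    -- A color with the fewest predecessors is minimal: a predecessor would have strictly fewer.
    obtain ⟨a, haT, hamin⟩ := Finset.exists_min_image T
      (fun j => (U.filter fun l => p.before l j).card) ⟨i, by simp [T, hi]⟩
    simp only [T, Finset.mem_filter] at haT hamin
    refine ⟨a, (hBmem a).2 ⟨haT.1, fun j hj => ?_⟩, haT.2⟩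
    have hjU : j ∈ U := (hpU j).1 (h2 _ _ hj)
    have := hamin j ⟨hjU, Or.inr (by grind)⟩
    refine absurd this (not_le.2 (Finset.card_lt_card ?_))
    rw [Finset.ssubset_iff_of_subset]
    · exact ⟨j, by simp [hjU, hj], by simp [h4]⟩
    · intro l
      simp only [Finset.mem_filter]
      grind
  obtain ⟨u, hu⟩ := hU
  obtain ⟨a, ha, -⟩ := hmin u hu
  have hfirst : ∀ i ∈ B, ∀ j ∈ U, j ∉ B → p.before i j := by
    intro i hi j hj hjB
    obtain ⟨c, hc, hcj⟩ := hmin j hj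
    rcases hcj with rfl | hcj
    · exact absurd hc hjB
    · rcases h6 c j i hcj ((hpU i).2 ((hBmem i).1 hi).1) with h | h
      · exact absurd h (((hBmem i).1 hi).2 c)
      · exact h
  have hsingle : ∀ i ∈ B, p.single i → ∀ j ∈ B, j = i := by
    intro i hi hs j hj
    by_contra hne
    rcases h7 i j hs ((hpU j).2 ((hBmem j).1 hj).1) hne with h | h
    · exact ((hBmem j).1 hj).2 i h
    · exact ((hBmem i).1 hi).2 j h
  -- Any `a` in `B` decides the flag, since a singleton color in `B` must equal `a`.
  refine ⟨(B, decide (p.single a)), mem_firstBlocks.2 ⟨Finset.filter_subset _ _, ⟨a, ha⟩, ?_⟩,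
    ⟨fun i => p.used i ∧ i ∉ B, fun i => p.single i ∧ i ∉ B,
      fun i j => p.before i j ∧ i ∉ B⟩, ⟨?_, ?_⟩, ?_⟩
  · intro h
    exact Finset.card_eq_one.2 ⟨a, Finset.eq_singleton_iff_unique_mem.2
      ⟨ha, hsingle a ha (by simpa using h)⟩⟩
  · constructor <;> grind
  · grind
  · simp only [prepend]
    ext i j
    · grind
    · simp only [decide_eq_true_eq]
      have := hsingle a ha
      have := hsingle i
      grind
    · dsimp only
      have := hfirst i
      grind

instance [Finite α] : Finite (ColorPattern α) :=
  Finite.of_injective (fun p : ColorPattern α => (p.used, p.single, p.before)) fun p q h => by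
    cases p; cases q; simpa using h

/-- The number of weak-order patterns using exactly `n` given colors. -/
def patternCount : ℕ → ℕ
  | 0 => 1
  | n + 1 => 2 * (n + 1) * patternCount n +
      ∑ i : Fin n, (n + 1).choose (i + 2) * patternCount (n - 1 - i)
decreasing_by all_goals omega

theorem patternCount_zero : patternCount 0 = 1 := by rw [patternCount]

theorem patternCount_succ (n : ℕ) : patternCount (n + 1) = 2 * (n + 1) * patternCount n +
    ∑ i ∈ Finset.range n, (n + 1).choose (i + 2) * patternCount (n - 1 - i) := by
  rw [patternCount, Finset.sum_range]

theorem patternCount_succ_eq_sum_Icc (n : ℕ) :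
    patternCount (n + 1) = 2 * (n + 1) * patternCount n +
      ∑ i ∈ Finset.Icc 2 (n + 1), (n + 1).choose i * patternCount (n + 1 - i) := by
  rw [patternCount_succ, ← Finset.Ico_add_one_right_eq_Icc, Finset.sum_Ico_eq_sum_range]
  congr 1
  refine Finset.sum_congr (by simp) fun i _ => ?_
  rw [add_comm 2 i, show n + 1 - (i + 2) = n - 1 - i by omega]

theorem sum_blockWeight (n : ℕ) :
    ∑ m ∈ Finset.range (n + 1 + 1), (n + 1).choose m * (blockWeight m * patternCount (n + 1 - m)) =
      patternCount (n + 1) := by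
  rw [Finset.sum_range_succ', Finset.sum_range_succ', patternCount_succ]
  simp only [blockWeight, zero_mul, mul_zero, add_zero, zero_add, Nat.choose_one_right, one_mul,
    add_tsub_cancel_right]
  rw [add_comm]
  congr 1
  · ring
  · refine Finset.sum_congr rfl fun i _ => ?_
    rw [show n + 1 - (i + 1 + 1) = n - 1 - i by omega]

/-- `prepend` is a bijection from pairs (first block, pattern on the remaining colors), so the count
obeys the same recursion as `patternCount`. -/
theorem card_patternsOn [Finite α] (U : Finset α) :
    Nat.card (patternsOn U) = patternCount U.card := by
  induction U using Finset.strongInduction with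
  | H U ih =>
  rcases U.eq_empty_or_nonempty with rfl | hU
  · rw [Finset.card_empty, patternCount_zero, Nat.card_eq_one_iff_unique]
    refine ⟨⟨fun p q => Subtype.ext ?_⟩, ⟨⟨⟨fun _ => False, fun _ => False, fun _ _ => False⟩, ?_⟩⟩⟩
    · obtain ⟨p, hp, hp'⟩ := p
      obtain ⟨q, hq, hq'⟩ := q
      have := hp.used_of_single
      have := hp.used_left
      have := hq.used_of_single
      have := hq.used_left
      ext <;> grind
    · exact ⟨by constructor <;> simp, by simp⟩
  · let e : (Σ b : firstBlocks U, patternsOn (U \ b.1.1)) → patternsOn U := fun x =>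
      ⟨prepend x.1.1.1 (x.1.1.2 = true) x.2.1, prepend_mem_patternsOn x.1.2 x.2.2⟩
    have he : Function.Bijective e := by
      constructor
      · rintro ⟨⟨b, hb⟩, p, hp⟩ ⟨⟨b', hb'⟩, p', hp'⟩ h
        obtain ⟨rfl, rfl⟩ := prepend_injective hb hb' hp hp' (congrArg Subtype.val h)
        rfl
      · rintro ⟨p, hp⟩
        obtain ⟨b, hb, q, hq, rfl⟩ := exists_eq_prepend hU hp
        exact ⟨⟨⟨b, hb⟩, q, hq⟩, rfl⟩
    rw [← Nat.card_congr (Equiv.ofBijective e he), Nat.card_sigma]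
    have hterm : ∀ b : firstBlocks U, Nat.card (patternsOn (U \ b.1.1)) =
        patternCount (U.card - b.1.1.card) := by
      rintro ⟨b, hb⟩
      obtain ⟨hsub, hne, -⟩ := mem_firstBlocks.1 hb
      rw [ih _ (Finset.sdiff_ssubset hsub hne), Finset.card_sdiff_of_subset hsub]
    simp only [hterm]
    rw [Finset.sum_coe_sort (firstBlocks U) fun b => patternCount (U.card - b.1.card),
      sum_firstBlocks U fun m => patternCount (U.card - m)]
    obtain ⟨n, hn⟩ := Nat.exists_eq_succ_of_ne_zero (Finset.card_ne_zero.2 hU)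
    rw [hn]
    exact sum_blockWeight n

theorem card_isWeakOrder (k : ℕ) : {p : ColorPattern (Fin k) | p.IsWeakOrder}.ncard =
    ∑ i ∈ Finset.range (k + 1), patternCount i * k.choose i := by
  classical
  let e : (Σ U : Finset (Fin k), patternsOn U) → {p : ColorPattern (Fin k) | p.IsWeakOrder} :=
    fun x => ⟨x.2.1, x.2.2.1⟩
  have he : Function.Bijective e := by
    constructor
    · rintro ⟨U, p, hp⟩ ⟨U', p', hp'⟩ h
      obtain rfl : p = p' := congrArg Subtype.val h
      obtain rfl : U = U' := by
        ext i
        rw [← hp.2, ← hp'.2]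
      rfl
    · rintro ⟨p, hp⟩
      exact ⟨⟨Finset.univ.filter p.used, p, hp, by simp⟩, rfl⟩
  rw [← Nat.card_coe_set_eq, ← Nat.card_congr (Equiv.ofBijective e he), Nat.card_sigma]
  simp only [card_patternsOn]
  have h := Finset.sum_powerset_apply_card patternCount (x := (Finset.univ : Finset (Fin k)))
  rw [Finset.powerset_univ, Finset.card_univ, Fintype.card_fin] at h
  rw [h]
  simp [mul_comm]

theorem card_isWeakOrder_all (k : ℕ) :
    {p : ColorPattern (Fin k) | p.IsWeakOrder ∧ ∀ i, p.used i}.ncard = patternCount k := by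
  have : {p : ColorPattern (Fin k) | p.IsWeakOrder ∧ ∀ i, p.used i} =
      patternsOn Finset.univ := by
    ext; simp [patternsOn]
  rw [this, ← Nat.card_coe_set_eq, card_patternsOn, Finset.card_univ, Fintype.card_fin]

end ColorPattern

/-! ### Renewal theorem -/

/-- A renewal theorem for waiting times of mean less than `2`. -/
theorem tendsto_renewal {p u : ℕ → ℝ} {μ : ℝ} (hp0 : p 0 = 0) (hp : ∀ n, 0 ≤ p n)
    (hsum : HasSum p 1) (hmean : HasSum (fun n : ℕ => (n : ℝ) * p n) μ) (hμ : μ < 2)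
    (hu : PowerSeries.mk u * (1 - PowerSeries.mk p) = 1) :
    Tendsto u atTop (𝓝 (1 / μ)) := by
  -- With tails `r` and increments `d` of `u`, as power series (1 - X) r = 1 - p and d = (1 - X) u,
  -- hence d r = 1. Once `d` is known to be absolutely summable, `u` converges to Σ d = 1 / Σ r = 1
  -- / μ.
  set r : ℕ → ℝ := fun m => 1 - ∑ i ∈ Finset.range (m + 1), p i with hr
  set d : ℕ → ℝ := fun n => u n - if n = 0 then 0 else u (n - 1) with hd
  have htail : ∀ N, HasSum (fun i => p (i + (N + 1))) (r N) := fun N =>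
    (hasSum_nat_add_iff' (N + 1)).2 hsum
  have hr_nonneg : ∀ N, 0 ≤ r N := fun N => (htail N).nonneg fun _ => hp _
  have hr0 : r 0 = 1 := by simp [hr, hp0]
  have hrsucc : ∀ n, r (n + 1) = r n - p (n + 1) := fun n => by
    simp only [hr, Finset.sum_range_succ _ (n + 1)]; ring
  have hpartial : ∀ N : ℕ, ∑ m ∈ Finset.range N, r m =
      N * r N + ∑ n ∈ Finset.range (N + 1), (n : ℝ) * p n := by
    intro N
    induction N with
    | zero => simp
    | succ N ih =>
      rw [Finset.sum_range_succ, ih, Finset.sum_range_succ _ (N + 1), hrsucc]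
      push_cast; ring
  -- N · P(T > N) is at most the part of the mean beyond N; hence the boundary term in the summation
  -- by parts of `hpartial` vanishes in the limit.
  have hmean_tail : ∀ N : ℕ, (N : ℝ) * r N ≤ μ - ∑ n ∈ Finset.range (N + 1), (n : ℝ) * p n := by
    intro N
    refine hasSum_le (fun i => ?_) ((htail N).mul_left (N : ℝ))
      ((hasSum_nat_add_iff' (N + 1)).2 hmean)
    refine mul_le_mul_of_nonneg_right ?_ (hp _)
    push_cast
    have : (0 : ℝ) ≤ i := Nat.cast_nonneg i
    linarith
  have hlim := (tendsto_add_atTop_iff_nat 1).2 hmean.tendsto_sum_nat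
  have hrsum : HasSum r μ := by
    rw [hasSum_iff_tendsto_nat_of_nonneg hr_nonneg]
    simp only [hpartial]
    have h0 : Tendsto (fun N : ℕ => (N : ℝ) * r N) atTop (𝓝 0) := by
      refine tendsto_of_tendsto_of_tendsto_of_le_of_le tendsto_const_nhds ?_
        (fun N => mul_nonneg (Nat.cast_nonneg N) (hr_nonneg N)) hmean_tail
      simpa using hlim.const_sub μ
    simpa using h0.add hlim
  have hrtail : HasSum (fun l => r (l + 1)) (μ - 1) := by
    simpa [hr0] using (hasSum_nat_add_iff' 1).2 hrsum
  have hR : (1 - PowerSeries.X) * PowerSeries.mk r = 1 - PowerSeries.mk p := by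
    ext n
    rcases n with _ | n
    · simp [sub_mul, hr0, hp0]
    · simp [sub_mul, PowerSeries.coeff_succ_X_mul, hrsucc, PowerSeries.coeff_one]
  have hD : (1 - PowerSeries.X) * PowerSeries.mk u = PowerSeries.mk d := by
    ext n
    rcases n with _ | n
    · simp [sub_mul, hd]
    · simp [sub_mul, PowerSeries.coeff_succ_X_mul, hd]
  have hDR : PowerSeries.mk d * PowerSeries.mk r = 1 := by
    rw [← hD, mul_right_comm, hR, mul_comm, hu]
  have hconv : ∀ n, ∑ x ∈ Finset.HasAntidiagonal.antidiagonal n, d x.1 * r x.2 =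
      if n = 0 then 1 else 0 := by
    intro n
    have := congrArg (PowerSeries.coeff n) hDR
    simpa [PowerSeries.coeff_mul, PowerSeries.coeff_one] using this
  have habs : ∀ n, |d n| ≤ (if n = 0 then 1 else 0) +
      ∑ i ∈ Finset.range n, |d i| * r (n - i) := by
    intro n
    have h := hconv n
    rw [Finset.Nat.sum_antidiagonal_eq_sum_range_succ (fun i j => d i * r j),
      Finset.sum_range_succ, Nat.sub_self, hr0, mul_one] at h
    have h' : d n = (if n = 0 then 1 else 0) + -∑ i ∈ Finset.range n, d i * r (n - i) := by
      linarith
    rw [h']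
    refine (abs_add_le _ _).trans (add_le_add ?_ ?_)
    · split_ifs <;> simp
    · rw [abs_neg]
      refine (Finset.abs_sum_le_sum_abs _ _).trans (le_of_eq ?_)
      simp only [abs_mul, abs_of_nonneg (hr_nonneg _)]
  -- As r 0 = 1 and the later tails add up to μ - 1, a partial sum D of |d| satisfies D ≤ 1 + D (μ -
  -- 1). This is where μ < 2 is needed.
  have hbound : ∀ N, ∑ n ∈ Finset.range N, |d n| ≤ 1 / (2 - μ) := by
    intro N
    have h1 : ∑ n ∈ Finset.range N, |d n| ≤
        1 + (∑ n ∈ Finset.range N, |d n|) * (μ - 1) := by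
      refine (Finset.sum_le_sum fun n _ => habs n).trans ?_
      rw [Finset.sum_add_distrib]
      refine add_le_add ?_ ?_
      · rw [Finset.sum_ite_eq']
        split_ifs <;> norm_num
      · rw [Finset.sum_comm' (t' := Finset.range N) (s' := fun i => Finset.Ico (i + 1) N)
          (by intro x y; simp only [Finset.mem_range, Finset.mem_Ico]; omega), Finset.sum_mul]
        refine Finset.sum_le_sum fun i _ => ?_
        rw [← Finset.mul_sum]
        refine mul_le_mul_of_nonneg_left ?_ (abs_nonneg _)
        rw [Finset.sum_Ico_eq_sum_range]
        refine le_trans (le_of_eq ?_) (sum_le_hasSum (Finset.range (N - (i + 1)))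
          (fun l _ => hr_nonneg (l + 1)) hrtail)
        refine Finset.sum_congr rfl fun l _ => ?_
        rw [show i + 1 + l - i = l + 1 by omega]
    rw [le_div_iff₀ (by linarith)]
    linarith
  have hdsum : Summable fun n => |d n| :=
    summable_of_sum_range_le (fun _ => abs_nonneg _) hbound
  have hprod := tsum_mul_tsum_eq_tsum_sum_antidiagonal_of_summable_norm (f := d) (g := r)
    (by simpa using hdsum) (by simpa [abs_of_nonneg (hr_nonneg _)] using hrsum.summable)
  simp only [hconv, tsum_ite_eq, hrsum.tsum_eq] at hprod
  have hu_eq : ∀ N, ∑ n ∈ Finset.range (N + 1), d n = u N := by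
    intro N
    induction N with
    | zero => simp [hd]
    | succ N ih => rw [Finset.sum_range_succ, ih]; simp [hd]
  have hμ0 : μ ≠ 0 := by rintro rfl; simp at hprod
  rw [← eq_div_iff hμ0] at hprod
  rw [← hprod]
  have := (tendsto_add_atTop_iff_nat 1).2 hdsum.of_abs.hasSum.tendsto_sum_nat
  simpa only [hu_eq] using this

/-! ### The pole, its residue and numerical bounds -/

theorem lambertW_spec : -1 ≤ lambertW (Real.exp 2) ∧
    lambertW (Real.exp 2) * Real.exp (lambertW (Real.exp 2)) = Real.exp 2 := by
  -- `Function.invFunOn` is a true preimage only where the value is attained; here w e^w runs from 0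
  -- to 2e² on [0, 2].
  have h : ∃ w ∈ Set.Ici (-1 : ℝ), (fun w : ℝ => w * Real.exp w) w = Real.exp 2 := by
    have hc : ContinuousOn (fun w : ℝ => w * Real.exp w) (Set.Icc 0 2) := by fun_prop
    obtain ⟨w, hw, hw'⟩ := intermediate_value_Icc (by norm_num : (0 : ℝ) ≤ 2) hc
      (show Real.exp 2 ∈ Set.Icc _ _ from
        ⟨by simpa using (Real.exp_pos 2).le, by
          have := Real.exp_pos 2
          linarith⟩)
    exact ⟨w, by simp only [Set.mem_Ici]; linarith [hw.1], hw'⟩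
  exact ⟨Function.invFunOn_mem h, Function.invFunOn_eq h⟩

theorem lambertW_eq : lambertW (Real.exp 2) = 2 - dominantPole := by
  rw [dominantPole]; ring

theorem exp_dominantPole : Real.exp dominantPole = 2 - dominantPole := by
  rw [← lambertW_eq, dominantPole, Real.exp_sub]
  exact (div_eq_iff (Real.exp_pos _).ne').2 lambertW_spec.2.symm

/-- Since e^x + x is increasing and equals 2 at Z, Taylor bounds for the exponential at two
rationals enclose Z. The enclosure, of width 2e-7, is tight enough for all three numerical claims.
-/
theorem dominantPole_gt : 0.4428543 < dominantPole := by
  by_contra! h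
  have h1 := Real.exp_le_exp.2 h
  rw [exp_dominantPole] at h1
  have h2 := Real.exp_bound' (x := 0.4428543) (by norm_num) (by norm_num) (n := 9) (by norm_num)
  norm_num [Finset.sum_range_succ, Nat.factorial] at h1 h2 h
  linarith

theorem dominantPole_lt : dominantPole < 0.4428545 := by
  by_contra! h
  have h1 := Real.exp_le_exp.2 h
  rw [exp_dominantPole] at h1
  have h2 := Real.sum_le_exp_of_nonneg (x := 0.4428545) (by norm_num) 10
  norm_num [Finset.sum_range_succ, Nat.factorial] at h1 h2 h
  linarith

theorem poleResidue_eq : poleResidue = -(2 - dominantPole) / (3 - dominantPole) := by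
  have hw := lambertW_spec.2
  rw [lambertW_eq] at hw
  have hZ := dominantPole_lt
  have h3 : 3 - dominantPole ≠ 0 := by norm_num at hZ; linarith
  rw [poleResidue, lambertW_eq, ← hw]
  have := Real.exp_pos (2 - dominantPole)
  rw [show Real.exp (2 - dominantPole) + (2 - dominantPole) * Real.exp (2 - dominantPole) =
    (3 - dominantPole) * Real.exp (2 - dominantPole) by ring]
  field_simp

/-- The denominator vanishes at Z with derivative -(1 + e^Z) = -(3 - Z), and the numerator there is
2 - Z. -/
theorem tendsto_residue :
    Tendsto (fun z : ℂ => (z - (dominantPole : ℂ)) *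
        (Complex.exp z / (2 - z - Complex.exp z)))
      (𝓝[≠] (dominantPole : ℂ)) (𝓝 (poleResidue : ℂ)) := by
  have hexp : Complex.exp dominantPole = 2 - dominantPole := by
    rw [← Complex.ofReal_exp, exp_dominantPole]; push_cast; ring
  have hZ := dominantPole_lt
  have h3 : (3 - dominantPole : ℂ) ≠ 0 := by
    have : (3 - dominantPole : ℝ) ≠ 0 := by norm_num at hZ; linarith
    exact_mod_cast this
  have hder : HasDerivAt (fun z : ℂ => 2 - z - Complex.exp z) (-(3 - dominantPole))
      (dominantPole : ℂ) := by
    have := ((hasDerivAt_id (dominantPole : ℂ)).const_sub 2).sub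
      (Complex.hasDerivAt_exp (dominantPole : ℂ))
    rw [hexp] at this
    exact this.congr_deriv (by ring)
  have hslope := (hasDerivAt_iff_tendsto_slope.1 hder).inv₀ (neg_ne_zero.2 h3)
  have hcont : Tendsto Complex.exp (𝓝[≠] (dominantPole : ℂ)) (𝓝 (2 - dominantPole)) := by
    rw [← hexp]
    exact Complex.continuous_exp.continuousAt.tendsto.mono_left nhdsWithin_le_nhds
  have hmul := hslope.mul hcont
  rw [show (-(3 - dominantPole : ℂ))⁻¹ * (2 - dominantPole) = (poleResidue : ℂ) by
    rw [poleResidue_eq]; push_cast; field_simp] at hmul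
  refine hmul.congr fun z => ?_
  rw [slope_def_field, hexp]
  simp only [sub_self, sub_zero, inv_div]
  ring

theorem abs_dominantPole_sub_lt : |dominantPole - 0.442854| < 1e-6 := by
  have h1 := dominantPole_gt
  have h2 := dominantPole_lt
  norm_num at h1 h2 ⊢
  rw [abs_lt]
  constructor <;> linarith

theorem abs_poleResidue_add_lt : |poleResidue + 0.6089389| < 1e-7 := by
  have h1 := dominantPole_gt
  have h2 := dominantPole_lt
  norm_num at h1 h2
  have h3 : 0 < 3 - dominantPole := by linarith
  rw [poleResidue_eq, abs_lt, div_add' _ _ _ h3.ne', lt_div_iff₀ h3, div_lt_iff₀ h3]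
  norm_num
  constructor <;> linarith

theorem abs_inv_lambertW_sub_lt : |1 / lambertW (Real.exp 2) - 0.6422007| < 1e-7 := by
  have h1 := dominantPole_gt
  have h2 := dominantPole_lt
  norm_num at h1 h2
  have h3 : 0 < 2 - dominantPole := by linarith
  rw [lambertW_eq, abs_lt, div_sub' h3.ne', lt_div_iff₀ h3, div_lt_iff₀ h3]
  norm_num
  constructor <;> linarith

/-! ### Generating functions and asymptotics -/

namespace ColorPattern

theorem sum_div_factorial (n : ℕ) :
    ∑ x ∈ Finset.HasAntidiagonal.antidiagonal (n + 1),
      (patternCount x.1 : ℝ) / x.1 ! * ((blockWeight x.2 : ℝ) / x.2 !) =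
      (patternCount (n + 1) : ℝ) / (n + 1)! := by
  rw [← sum_blockWeight n, ← Finset.Nat.sum_antidiagonal_swap,
    Finset.Nat.sum_antidiagonal_eq_sum_range_succ_mk, Nat.cast_sum, Finset.sum_div]
  refine Finset.sum_congr rfl fun m hm => ?_
  have hm' : m ≤ n + 1 := by simpa [Nat.lt_succ_iff] using hm
  simp only [Prod.swap, Nat.cast_mul, Nat.cast_choose ℝ hm']
  have := Nat.factorial_ne_zero (n + 1)
  have := Nat.factorial_ne_zero m
  have := Nat.factorial_ne_zero (n + 1 - m)
  field_simp

theorem sub_blockWeight_eq : (2 - PowerSeries.X - PowerSeries.exp ℝ : PowerSeries ℝ) =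
    1 - PowerSeries.mk fun n => (blockWeight n : ℝ) / n ! := by
  have h2 : (2 : PowerSeries ℝ) = PowerSeries.C 2 := (map_ofNat PowerSeries.C 2).symm
  rw [h2]
  ext n
  rcases n with _ | _ | n
  · norm_num [blockWeight, PowerSeries.coeff_exp]
  · norm_num [blockWeight, PowerSeries.coeff_exp, PowerSeries.coeff_C, PowerSeries.coeff_one]
  · simp [blockWeight, PowerSeries.coeff_exp, PowerSeries.coeff_one, PowerSeries.coeff_X]

/-- The exponential generating function of `patternCount`. -/
theorem mk_patternCount_mul :
    (PowerSeries.mk fun n => (patternCount n : ℝ) / n !) *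
      (1 - PowerSeries.mk fun n => (blockWeight n : ℝ) / n !) = 1 := by
  ext n
  rcases n with _ | n
  · simp [PowerSeries.coeff_mul, blockWeight, patternCount_zero]
  · rw [mul_sub, mul_one, map_sub, PowerSeries.coeff_mul]
    simp only [PowerSeries.coeff_mk, sum_div_factorial]
    simp [PowerSeries.coeff_one]

/-- The number of weak-order patterns on subsets of `n` given colors. -/
def totalCount (k : ℕ) : ℕ := ∑ i ∈ Finset.range (k + 1), patternCount i * k.choose i

theorem mk_totalCount : (PowerSeries.mk fun n => (totalCount n : ℝ) / n !) =
    PowerSeries.exp ℝ * PowerSeries.mk fun n => (patternCount n : ℝ) / n ! := by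
  ext n
  rw [mul_comm, PowerSeries.coeff_mul, PowerSeries.coeff_mk,
    Finset.Nat.sum_antidiagonal_eq_sum_range_succ_mk, totalCount, Nat.cast_sum, Finset.sum_div]
  refine Finset.sum_congr rfl fun m hm => ?_
  have hm' : m ≤ n := by simpa [Nat.lt_succ_iff] using hm
  simp only [Nat.cast_mul, Nat.cast_choose ℝ hm', PowerSeries.coeff_mk, PowerSeries.coeff_exp]
  have := Nat.factorial_ne_zero n
  have := Nat.factorial_ne_zero m
  have := Nat.factorial_ne_zero (n - m)
  simp only [map_div₀, map_one, map_natCast]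
  field_simp

theorem mk_totalCount_eq_exp_mul_inv : (PowerSeries.mk fun n => (totalCount n : ℝ) / n !) =
    PowerSeries.exp ℝ * (2 - PowerSeries.X - PowerSeries.exp ℝ)⁻¹ := by
  rw [mk_totalCount]
  congr 1
  rw [PowerSeries.eq_inv_iff_mul_eq_one, sub_blockWeight_eq, mk_patternCount_mul]
  rw [sub_blockWeight_eq]
  simp [blockWeight]

/-- Writing e^x = (2 - x) - (2 - x - e^x) turns e^x/(2 - x - e^x) into (2 - x) P - 1, where P is the
series of `patternCount`. Limits for L then come from those for J without a convolution. -/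
theorem totalCount_succ_div (n : ℕ) : (totalCount (n + 1) : ℝ) / (n + 1)! =
    2 * ((patternCount (n + 1) : ℝ) / (n + 1)!) - (patternCount n : ℝ) / n ! := by
  have h : (PowerSeries.mk fun n => (totalCount n : ℝ) / n !) =
      PowerSeries.C 2 * (PowerSeries.mk fun n => (patternCount n : ℝ) / n !) -
      PowerSeries.X * (PowerSeries.mk fun n => (patternCount n : ℝ) / n !) - 1 := by
    have h1 := mk_patternCount_mul
    rw [← sub_blockWeight_eq] at h1
    rw [mk_totalCount, ← h1, show PowerSeries.C (2 : ℝ) = 2 from map_ofNat _ 2]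
    ring
  have := congrArg (PowerSeries.coeff (n + 1)) h
  simpa [PowerSeries.coeff_one, PowerSeries.coeff_succ_X_mul] using this

theorem hasSum_blockWeight (z : ℝ) :
    HasSum (fun n : ℕ => (blockWeight n : ℝ) / n ! * z ^ n) (Real.exp z + z - 1) := by
  have h := NormedSpace.expSeries_div_hasSum_exp z
  rw [← Real.exp_eq_exp_ℝ] at h
  refine ((h.add (hasSum_ite_eq 1 z)).sub (hasSum_ite_eq 0 1)).congr_fun ?_
  intro n
  rcases n with _ | _ | n
  · simp [blockWeight]
  · simp [blockWeight]; ring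
  · simp [blockWeight]; ring

theorem hasSum_mul_blockWeight (z : ℝ) :
    HasSum (fun n : ℕ => (n : ℝ) * ((blockWeight n : ℝ) / n ! * z ^ n))
      (z * (Real.exp z + 1)) := by
  have h := NormedSpace.expSeries_div_hasSum_exp z
  rw [← Real.exp_eq_exp_ℝ] at h
  rw [← hasSum_nat_add_iff' 1]
  simp only [Finset.range_one, Finset.sum_singleton, Nat.cast_zero, zero_mul, sub_zero]
  refine ((h.add (hasSum_ite_eq 0 1)).mul_left z).congr_fun ?_
  intro n
  rcases n with _ | n
  · simp [blockWeight]; ring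
  · have := Nat.factorial_ne_zero (n + 1)
    have : ((n : ℝ) + 1 + 1) ≠ 0 := by positivity
    simp [blockWeight, Nat.factorial_succ (n + 1)]
    field_simp
    ring

theorem tendsto_patternCount :
    Tendsto (fun n : ℕ => (patternCount n : ℝ) / n ! * dominantPole ^ n) atTop
      (𝓝 (1 / (dominantPole * (3 - dominantPole)))) := by
  have h1 := dominantPole_gt
  have h2 := dominantPole_lt
  norm_num at h1 h2
  have h0 : 0 < dominantPole := by linarith
  refine tendsto_renewal (p := fun n => (blockWeight n : ℝ) / n ! * dominantPole ^ n)
    (by simp [blockWeight]) (fun n => by positivity) ?_ ?_ ?_ ?_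
  · convert hasSum_blockWeight dominantPole using 1
    rw [exp_dominantPole]; ring
  · convert hasSum_mul_blockWeight dominantPole using 1
    rw [exp_dominantPole]; ring
  · nlinarith
  -- Substituting Zx for x turns the generating function identity into the renewal equation.
  · have h := congrArg (PowerSeries.rescale dominantPole) mk_patternCount_mul
    rw [map_mul, map_sub, map_one] at h
    rw [← h]
    congr 2
    · ext n; simp [PowerSeries.coeff_rescale, mul_comm]
    · ext n; simp [PowerSeries.coeff_rescale, mul_comm]

theorem tendsto_totalCount :
    Tendsto (fun n : ℕ => (totalCount n : ℝ) / n ! * dominantPole ^ n) atTop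
      (𝓝 ((2 - dominantPole) / (dominantPole * (3 - dominantPole)))) := by
  rw [← tendsto_add_atTop_iff_nat 1]
  have h := (((tendsto_add_atTop_iff_nat 1).2 tendsto_patternCount).const_mul 2).sub
    (tendsto_patternCount.const_mul dominantPole)
  convert h using 2 with n
  · rw [totalCount_succ_div]; ring
  · ring

theorem isEquivalent_totalCount :
    Asymptotics.IsEquivalent atTop (fun k : ℕ => (totalCount k : ℝ))
      (fun k : ℕ => -((k ! : ℝ) * poleResidue * (1 / dominantPole) ^ (k + 1))) := by
  have h1 := dominantPole_gt
  have h2 := dominantPole_lt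
  norm_num at h1 h2
  have h0 : dominantPole ≠ 0 := by linarith
  have h3 : 3 - dominantPole ≠ 0 := by linarith
  have h4 : 2 - dominantPole ≠ 0 := by linarith
  rw [poleResidue_eq]
  refine Asymptotics.isEquivalent_of_tendsto_one ?_
  have h := tendsto_totalCount.div_const ((2 - dominantPole) / (dominantPole * (3 - dominantPole)))
  rw [div_self (by positivity)] at h
  refine h.congr fun k => ?_
  have := Nat.factorial_ne_zero k
  simp only [Pi.div_apply, one_div, inv_pow, pow_succ]
  field_simp

theorem tendsto_patternCount_div_totalCount :
    Tendsto (fun k : ℕ => (patternCount k : ℝ) / (totalCount k : ℝ)) atTop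
      (𝓝 (1 / lambertW (Real.exp 2))) := by
  have h1 := dominantPole_gt
  have h2 := dominantPole_lt
  norm_num at h1 h2
  have h0 : dominantPole ≠ 0 := by linarith
  have h3 : 3 - dominantPole ≠ 0 := by linarith
  have h4 : 2 - dominantPole ≠ 0 := by linarith
  have h := tendsto_patternCount.div tendsto_totalCount (by positivity)
  rw [lambertW_eq]
  convert h using 2 with k
  · have := Nat.factorial_ne_zero k
    simp only [Pi.div_apply]
    field_simp
  · field_simp

end ColorPattern

/-! ### Counting isomorphism types by a complete invariant -/

/-- A complete invariant with set of values `V` identifies the isomorphism types of a class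
of structures with `V`. -/
theorem isoTypes_ncard_eq {L : FirstOrder.Language.{0, 0}} {K : Set (Bundled.{0} L.Structure)}
    {γ : Type*} [Finite γ] (f : Bundled.{0} L.Structure → γ) (V : Set γ)
    (hV : ∀ M ∈ K, f M ∈ V)
    (hinv : ∀ M ∈ K, ∀ N ∈ K, Nonempty (M ≃[L] N) → f M = f N)
    (hcomplete : ∀ M ∈ K, ∀ N ∈ K, f M = f N → Nonempty (M ≃[L] N))
    (hsurj : ∀ v ∈ V, ∃ M ∈ K, f M = v) :
    (isoTypes K).Finite ∧ (isoTypes K).ncard = V.ncard := by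
  choose g hgK hg using hsurj
  have himage : isoTypes K =
      Set.range fun v : V => Quotient.mk (equivSetoid (L := L)) (g v.1 v.2) := by
    ext q
    constructor
    · rintro ⟨M, hM, rfl⟩
      exact ⟨⟨f M, hV M hM⟩,
        Quotient.sound (hcomplete _ (hgK _ (hV M hM)) _ hM (hg _ (hV M hM)))⟩
    · rintro ⟨v, rfl⟩
      exact ⟨g v.1 v.2, hgK v.1 v.2, rfl⟩
  rw [himage]
  refine ⟨Set.finite_range _, ?_⟩
  rw [← Nat.card_coe_set_eq, ← Nat.card_coe_set_eq]
  refine Nat.card_range_of_injective fun v w h => Subtype.ext ?_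
  rw [← hg v.1 v.2, ← hg w.1 w.2]
  exact hinv _ (hgK v.1 v.2) _ (hgK w.1 w.2) (Quotient.exact h)

/-! ### Classification of multicolored orderings -/

section MultiColored

variable {k : ℕ}

/-- The order relation of a multicolored ordering. -/
def multiLt (k : ℕ) {M : Type} [(multiColoredLang k).Structure M] (x y : M) : Prop :=
  Structure.RelMap (L := multiColoredLang k) MultiColoredRel.lt ![x, y]

theorem multiColored_relMap_iff {M N : Type} [(multiColoredLang k).Structure M]
    [(multiColoredLang k).Structure N] (f : M → N)
    (hlt : ∀ x y, multiLt k (f x) (f y) ↔ multiLt k x y)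
    (hR : ∀ (i : Fin k) x, predR i (f x) ↔ predR i x)
    (hS : ∀ (i : Fin k) x, predS i (f x) ↔ predS i x)
    {n : ℕ} (r : (multiColoredLang k).Relations n) (v : Fin n → M) :
    Structure.RelMap r (f ∘ v) ↔ Structure.RelMap r v := by
  change MultiColoredRel k n at r
  cases r with
  | lt =>
    rw [show v = ![v 0, v 1] by ext i; fin_cases i <;> rfl,
      show f ∘ ![v 0, v 1] = ![f (v 0), f (v 1)] by ext i; fin_cases i <;> rfl]
    exact hlt _ _
  | R i =>
    rw [show v = ![v 0] by ext i; fin_cases i; rfl,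
      show f ∘ ![v 0] = ![f (v 0)] by ext i; fin_cases i; rfl]
    exact hR _ _
  | S i =>
    rw [show v = ![v 0] by ext i; fin_cases i; rfl,
      show f ∘ ![v 0] = ![f (v 0)] by ext i; fin_cases i; rfl]
    exact hS _ _

section

variable {M N : Type} [(multiColoredLang k).Structure M] [(multiColoredLang k).Structure N]

theorem multiLt_equiv (e : M ≃[multiColoredLang k] N) (x y : M) :
    multiLt k (e x) (e y) ↔ multiLt k x y := by
  have := StrongHomClass.map_rel e (MultiColoredRel.lt : (multiColoredLang k).Relations 2) ![x, y]
  rwa [show e ∘ ![x, y] = ![e x, e y] by ext i; fin_cases i <;> rfl] at this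

theorem predR_equiv (e : M ≃[multiColoredLang k] N) (i : Fin k) (x : M) :
    predR i (e x) ↔ predR i x := by
  have := StrongHomClass.map_rel e (MultiColoredRel.R i : (multiColoredLang k).Relations 1) ![x]
  rwa [show e ∘ ![x] = ![e x] by ext i; fin_cases i; rfl] at this

theorem predS_equiv (e : M ≃[multiColoredLang k] N) (i : Fin k) (x : M) :
    predS i (e x) ↔ predS i x := by
  have := StrongHomClass.map_rel e (MultiColoredRel.S i : (multiColoredLang k).Relations 1) ![x]
  rwa [show e ∘ ![x] = ![e x] by ext i; fin_cases i; rfl] at this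

/-- The point `x` carries the label `i`, as `R i` or as `S i`. -/
def hasLabel (i : Fin k) (x : M) : Prop := predR i x ∨ predS i x

theorem hasLabel_equiv (e : M ≃[multiColoredLang k] N) (i : Fin k) (x : M) :
    hasLabel i (e x) ↔ hasLabel i x :=
  or_congr (predR_equiv e i x) (predS_equiv e i x)

variable (k M) in
/-- The pattern of a multicolored ordering. -/
def multiPattern : ColorPattern (Fin k) where
  used i := ∃ x : M, hasLabel i x
  single i := ∃ x : M, predR i x
  before i j := ∃ x y : M, hasLabel i x ∧ hasLabel j y ∧ multiLt k x y

theorem multiPattern_congr (e : M ≃[multiColoredLang k] N) :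
    multiPattern k M = multiPattern k N := by
  ext i j
  · exact e.toEquiv.exists_congr fun x => (hasLabel_equiv e i x).symm
  · exact e.toEquiv.exists_congr fun x => (predR_equiv e i x).symm
  · exact e.toEquiv.exists_congr fun x => e.toEquiv.exists_congr fun y =>
      and_congr (hasLabel_equiv e i x).symm
        (and_congr (hasLabel_equiv e j y).symm (multiLt_equiv e x y).symm)

namespace IsMultiColoredOrder

theorem lt_irrefl (hM : IsMultiColoredOrder k M) (x : M) : ¬ multiLt k x x := hM.linear.irrefl x

theorem lt_trans (hM : IsMultiColoredOrder k M)
    {x y z : M} : multiLt k x y → multiLt k y z → multiLt k x z :=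
  hM.linear.trans x y z

theorem lt_trichotomy (hM : IsMultiColoredOrder k M)
    (x y : M) : multiLt k x y ∨ x = y ∨ multiLt k y x :=
  have : IsStrictTotalOrder M (multiLt k) := hM.linear
  trichotomous_of (multiLt k) x y

theorem label_unique (hM : IsMultiColoredOrder k M)
    {i : Fin k} {x y : M} (hx : hasLabel i x) (hy : hasLabel i y) : x = y := by
  rcases hx with hx | hx <;> rcases hy with hy | hy
  · exact hM.R_unique i x y hx hy
  · exact absurd ⟨hx, hy⟩ (hM.R_S_disjoint i x y)
  · exact absurd ⟨hy, hx⟩ (hM.R_S_disjoint i y x)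
  · exact hM.S_unique i x y hx hy

theorem before_iff (hM : IsMultiColoredOrder k M)
    {i j : Fin k} {x y : M} (hx : hasLabel i x) (hy : hasLabel j y) :
    (multiPattern k M).before i j ↔ multiLt k x y := by
  constructor
  · rintro ⟨x', y', hx', hy', h⟩
    rwa [hM.label_unique hx hx', hM.label_unique hy hy']
  · exact fun h => ⟨x, y, hx, hy, h⟩

theorem predR_iff (hM : IsMultiColoredOrder k M) {i : Fin k} {x : M} (hx : hasLabel i x) :
    predR i x ↔ (multiPattern k M).single i := by
  constructor
  · exact fun h => ⟨x, h⟩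
  · rintro ⟨y, hy⟩
    rwa [hM.label_unique hx (Or.inl hy)]

theorem predS_iff (hM : IsMultiColoredOrder k M) {i : Fin k} {x : M} (hx : hasLabel i x) :
    predS i x ↔ ¬ (multiPattern k M).single i := by
  rw [← hM.predR_iff hx]
  constructor
  · exact fun h h' => hM.R_S_disjoint i x x ⟨h', h⟩
  · exact fun h => hx.resolve_left h

theorem isWeakOrder (hM : IsMultiColoredOrder k M) : (multiPattern k M).IsWeakOrder where
  used_of_single := fun i ⟨x, hx⟩ => ⟨x, Or.inl hx⟩
  used_left := fun i j ⟨x, _, hx, _⟩ => ⟨x, hx⟩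
  used_right := fun i j ⟨_, y, _, hy, _⟩ => ⟨y, hy⟩
  irrefl := by
    rintro i ⟨x, y, hx, hy, h⟩
    rw [hM.label_unique hx hy] at h
    exact hM.lt_irrefl _ h
  trans := by
    rintro i j l ⟨x, y, hx, hy, h⟩ ⟨y', z, hy', hz, h'⟩
    rw [← hM.label_unique hy hy'] at h'
    exact ⟨x, z, hx, hz, hM.lt_trans h h'⟩
  weak := by
    rintro i j l ⟨x, y, hx, hy, h⟩ ⟨z, hz⟩
    rcases hM.lt_trichotomy x z with h' | rfl | h'
    · exact Or.inl ⟨x, z, hx, hz, h'⟩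
    · exact Or.inr ⟨x, y, hz, hy, h⟩
    · exact Or.inr ⟨z, y, hz, hy, hM.lt_trans h' h⟩
  single_comparable := by
    rintro i j ⟨x, hx⟩ ⟨y, hy⟩ hji
    rcases hM.lt_trichotomy x y with h | rfl | h
    · exact Or.inl ⟨x, y, Or.inl hx, hy, h⟩
    · rcases hy with hy | hy
      · exact absurd ⟨hx, hy⟩ (hM.not_R_R x i j hji.symm)
      · exact absurd ⟨hx, hy⟩ (hM.not_R_S x i j)
    · exact Or.inr ⟨y, x, hy, Or.inl hx, h⟩

/-- The labels at a point are those incomparable with any one of them, so the pattern determines the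
label set of each point. -/
theorem exists_hasLabel_iff (hM : IsMultiColoredOrder k M) (hN : IsMultiColoredOrder k N)
    (h : multiPattern k M = multiPattern k N) (x : M) :
    ∃ y : N, ∀ i : Fin k, hasLabel i x ↔ hasLabel i y := by
  obtain ⟨i, hi⟩ := hM.exists_color x
  have hused : (multiPattern k N).used i := h ▸ ⟨x, hi⟩
  obtain ⟨y, hy⟩ := hused
  refine ⟨y, fun j => ?_⟩
  constructor
  · intro hj
    have hused : (multiPattern k N).used j := h ▸ ⟨x, hj⟩
    obtain ⟨z, hz⟩ := hused
    rcases hN.lt_trichotomy y z with h' | rfl | h'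
    · rw [← hN.before_iff hy hz, ← h, hM.before_iff hi hj] at h'
      exact absurd h' (hM.lt_irrefl x)
    · exact hz
    · rw [← hN.before_iff hz hy, ← h, hM.before_iff hj hi] at h'
      exact absurd h' (hM.lt_irrefl x)
  · intro hj
    have hused : (multiPattern k M).used j := h ▸ ⟨y, hj⟩
    obtain ⟨z, hz⟩ := hused
    rcases hM.lt_trichotomy x z with h' | rfl | h'
    · rw [← hM.before_iff hi hz, h, hN.before_iff hy hj] at h'
      exact absurd h' (hN.lt_irrefl y)
    · exact hz
    · rw [← hM.before_iff hz hi, h, hN.before_iff hj hy] at h'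
      exact absurd h' (hN.lt_irrefl y)

theorem nonempty_equiv (hM : IsMultiColoredOrder k M) (hN : IsMultiColoredOrder k N)
    (h : multiPattern k M = multiPattern k N) :
    Nonempty (M ≃[multiColoredLang k] N) := by
  choose f hf using hM.exists_hasLabel_iff hN h
  choose g hg using hN.exists_hasLabel_iff hM h.symm
  have hgf : ∀ x, g (f x) = x := fun x => by
    obtain ⟨i, hi⟩ := hM.exists_color x
    exact hM.label_unique ((hg _ i).1 ((hf _ i).1 hi)) hi
  have hfg : ∀ y, f (g y) = y := fun y => by
    obtain ⟨i, hi⟩ := hN.exists_color y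
    exact hN.label_unique ((hf _ i).1 ((hg _ i).1 hi)) hi
  refine ⟨⟨⟨f, g, hgf, hfg⟩, fun F => F.elim, multiColored_relMap_iff f ?_ ?_ ?_⟩⟩
  · intro x y
    obtain ⟨i, hi⟩ := hM.exists_color x
    obtain ⟨j, hj⟩ := hM.exists_color y
    rw [← hM.before_iff hi hj, h, hN.before_iff ((hf x i).1 hi) ((hf y j).1 hj)]
  · intro i x
    by_cases hi : hasLabel i x
    · rw [hM.predR_iff hi, h, hN.predR_iff ((hf x i).1 hi)]
    · exact iff_of_false (fun h' => hi ((hf x i).2 (Or.inl h'))) fun h' => hi (Or.inl h')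
  · intro i x
    by_cases hi : hasLabel i x
    · rw [hM.predS_iff hi, h, hN.predS_iff ((hf x i).1 hi)]
    · exact iff_of_false (fun h' => hi ((hf x i).2 (Or.inr h'))) fun h' => hi (Or.inr h')

end IsMultiColoredOrder

end

/-- The points of the standard multicolored ordering with a given pattern: the least
representatives of the blocks. -/
def BlockOrder (p : ColorPattern (Fin k)) : Type :=
  {i : Fin k // p.used i ∧ ∀ j, p.used j → ¬ p.before i j → ¬ p.before j i → i ≤ j}

/-- In a weak order a singleton color is alone in its block, hence is its own representative; so `R`
can ask for equality, while `S` asks only for membership in the block. -/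
instance (p : ColorPattern (Fin k)) : (multiColoredLang k).Structure (BlockOrder p) where
  funMap := fun F => F.elim
  RelMap := fun {n} (r : MultiColoredRel k n) => match n, r with
    | _, .lt => fun v => p.before (v 0).1 (v 1).1
    | _, .R i => fun v => p.single i ∧ (v 0).1 = i
    | _, .S i => fun v => p.used i ∧ ¬ p.single i ∧ ¬ p.before i (v 0).1 ∧ ¬ p.before (v 0).1 i

theorem BlockOrder.isMultiColoredOrder {p : ColorPattern (Fin k)} (hp : p.IsWeakOrder) :
    IsMultiColoredOrder k (BlockOrder p) := by
  obtain ⟨h1, h2, h3, h4, h5, h6, h7⟩ := hp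
  have heq : ∀ x y : BlockOrder p, ¬ p.before x.1 y.1 → ¬ p.before y.1 x.1 → x = y :=
    fun x y h h' => Subtype.ext (le_antisymm (x.2.2 _ y.2.1 h h') (y.2.2 _ x.2.1 h' h))
  refine ⟨?_, ?_, ?_, ?_, ?_, ?_, ?_⟩
  · refine { trichotomous := ?_, irrefl := ?_, trans := ?_ }
    · exact fun x y h h' => heq x y h h'
    · exact fun x => h4 x.1
    · exact fun x y z => h5 x.1 y.1 z.1
  · intro x
    refine ⟨x.1, ?_⟩
    by_cases hs : p.single x.1
    · exact Or.inl ⟨hs, rfl⟩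
    · exact Or.inr ⟨x.2.1, hs, h4 _, h4 _⟩
  · rintro x i j hij ⟨⟨-, hi⟩, ⟨-, hj⟩⟩
    exact hij (hi.symm.trans hj)
  · rintro x i j ⟨⟨hs, hi⟩, ⟨hu, hn, hb, hb'⟩⟩
    change x.1 = i at hi
    change ¬ p.before j x.1 at hb
    change ¬ p.before x.1 j at hb'
    grind
  · rintro i x y ⟨-, hi⟩ ⟨-, hj⟩
    exact Subtype.ext (hi.trans hj.symm)
  · rintro i x y ⟨hu, hn, hb, hb'⟩ ⟨-, -, hc, hc'⟩
    change ¬ p.before i x.1 at hb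
    change ¬ p.before x.1 i at hb'
    change ¬ p.before i y.1 at hc
    change ¬ p.before y.1 i at hc'
    apply heq <;> grind
  · rintro i x y ⟨⟨hs, -⟩, ⟨-, hn, -⟩⟩
    exact hn hs

theorem BlockOrder.multiPattern_eq {p : ColorPattern (Fin k)} (hp : p.IsWeakOrder) :
    multiPattern k (BlockOrder p) = p := by
  obtain ⟨h1, h2, h3, h4, h5, h6, h7⟩ := hp
  have hlab : ∀ i (x : BlockOrder p), hasLabel i x ↔
      p.used i ∧ ¬ p.before i x.1 ∧ ¬ p.before x.1 i := by
    intro i x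
    change (p.single i ∧ x.1 = i) ∨
      (p.used i ∧ ¬ p.single i ∧ ¬ p.before i x.1 ∧ ¬ p.before x.1 i) ↔ _
    have := x.2.1
    grind
  have hex : ∀ i, p.used i → ∃ x : BlockOrder p, ¬ p.before i x.1 ∧ ¬ p.before x.1 i := by
    classical
    intro i hi
    obtain ⟨a, ha, hmin⟩ := Finset.exists_min_image
      (Finset.univ.filter fun j => p.used j ∧ ¬ p.before i j ∧ ¬ p.before j i) id
      ⟨i, by simp [hi, h4]⟩
    simp only [Finset.mem_filter, Finset.mem_univ, true_and, id] at ha hmin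
    refine ⟨⟨a, ha.1, fun j hj hb hb' => hmin j ⟨hj, ?_, ?_⟩⟩, ha.2⟩ <;> grind
  ext i j
  · constructor
    · rintro ⟨x, hx⟩
      exact ((hlab i x).1 hx).1
    · intro hi
      obtain ⟨x, hx⟩ := hex i hi
      exact ⟨x, (hlab i x).2 ⟨hi, hx⟩⟩
  · constructor
    · rintro ⟨x, hx, -⟩
      exact hx
    · intro hi
      obtain ⟨x, hx⟩ := hex i (h1 i hi)
      refine ⟨x, hi, ?_⟩
      change x.1 = i
      have := x.2.1
      grind
  · constructor
    · rintro ⟨x, y, hx, hy, h⟩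
      rw [hlab] at hx hy
      change p.before x.1 y.1 at h
      grind
    · intro h
      obtain ⟨x, hx⟩ := hex i (h2 i j h)
      obtain ⟨y, hy⟩ := hex j (h3 i j h)
      refine ⟨x, y, (hlab i x).2 ⟨h2 i j h, hx⟩, (hlab j y).2 ⟨h3 i j h, hy⟩, ?_⟩
      change p.before x.1 y.1
      have := x.2.1
      have := y.2.1
      grind

theorem isoTypes_multiColoredOrders (k : ℕ) : (isoTypes (multiColoredOrders k)).Finite ∧
    (isoTypes (multiColoredOrders k)).ncard =
      {p : ColorPattern (Fin k) | p.IsWeakOrder}.ncard :=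
  isoTypes_ncard_eq (fun M => multiPattern k M) _
    (fun _ hM => IsMultiColoredOrder.isWeakOrder hM)
    (fun _ _ _ _ ⟨e⟩ => multiPattern_congr e)
    (fun _ hM _ hN h => IsMultiColoredOrder.nonempty_equiv hM hN h)
    (fun p hp => ⟨⟨BlockOrder p, inferInstance⟩, BlockOrder.isMultiColoredOrder hp,
      BlockOrder.multiPattern_eq hp⟩)

end MultiColored

/-! ### Homogeneous colored orderings and their patterns -/

section Colored

variable {k : ℕ}

instance (n : ℕ) : IsEmpty ((coloredOrderLang k).Functions n) := inferInstanceAs (IsEmpty Empty)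

instance : IsEmpty ((coloredOrderLang k).Relations 0) := ⟨fun r => by
  change ColoredOrderRel k 0 at r
  cases r⟩

/-- The order relation of a colored ordering. -/
def colLt (k : ℕ) {M : Type} [(coloredOrderLang k).Structure M] (x y : M) : Prop :=
  Structure.RelMap (L := coloredOrderLang k) ColoredOrderRel.lt ![x, y]

/-- The point `x` has color `i`. -/
def hasColor {M : Type} [(coloredOrderLang k).Structure M] (i : Fin k) (x : M) : Prop :=
  Structure.RelMap (L := coloredOrderLang k) (ColoredOrderRel.color i) ![x]

theorem colored_relMap_iff {M N : Type} [(coloredOrderLang k).Structure M]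
    [(coloredOrderLang k).Structure N] (f : M → N)
    (hlt : ∀ x y, colLt k (f x) (f y) ↔ colLt k x y)
    (hcol : ∀ (i : Fin k) x, hasColor i (f x) ↔ hasColor i x)
    {n : ℕ} (r : (coloredOrderLang k).Relations n) (v : Fin n → M) :
    Structure.RelMap r (f ∘ v) ↔ Structure.RelMap r v := by
  change ColoredOrderRel k n at r
  cases r with
  | lt =>
    rw [show v = ![v 0, v 1] by ext i; fin_cases i <;> rfl,
      show f ∘ ![v 0, v 1] = ![f (v 0), f (v 1)] by ext i; fin_cases i <;> rfl]
    exact hlt _ _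
  | color i =>
    rw [show v = ![v 0] by ext i; fin_cases i; rfl,
      show f ∘ ![v 0] = ![f (v 0)] by ext i; fin_cases i; rfl]
    exact hcol _ _

variable {M N : Type} [(coloredOrderLang k).Structure M] [(coloredOrderLang k).Structure N]

theorem colLt_map {F : Type*} [FunLike F M N] [StrongHomClass (coloredOrderLang k) F M N]
    (e : F) (x y : M) : colLt k (e x) (e y) ↔ colLt k x y := by
  have := StrongHomClass.map_rel e (ColoredOrderRel.lt : (coloredOrderLang k).Relations 2) ![x, y]
  rwa [show e ∘ ![x, y] = ![e x, e y] by ext i; fin_cases i <;> rfl] at this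

theorem hasColor_map {F : Type*} [FunLike F M N] [StrongHomClass (coloredOrderLang k) F M N]
    (e : F) (i : Fin k) (x : M) : hasColor i (e x) ↔ hasColor i x := by
  have := StrongHomClass.map_rel e
    (ColoredOrderRel.color i : (coloredOrderLang k).Relations 1) ![x]
  rwa [show e ∘ ![x] = ![e x] by ext i; fin_cases i; rfl] at this

theorem colLt_coe (S : (coloredOrderLang k).Substructure M) (x y : S) :
    colLt k (x : M) (y : M) ↔ colLt k x y :=
  colLt_map S.subtype x y

theorem hasColor_coe (S : (coloredOrderLang k).Substructure M) (i : Fin k) (x : S) :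
    hasColor i (x : M) ↔ hasColor i x :=
  hasColor_map S.subtype i x

variable (k M) in
/-- The pattern of a colored ordering. -/
def colPattern : ColorPattern (Fin k) where
  used i := ∃ x : M, hasColor i x
  single i := ∃ x : M, hasColor i x ∧ ∀ y : M, hasColor i y → y = x
  before i j := (∃ x : M, hasColor i x) ∧ (∃ y : M, hasColor j y) ∧
    ∀ x y : M, hasColor i x → hasColor j y → colLt k x y

theorem colPattern_congr (e : M ≃[coloredOrderLang k] N) : colPattern k M = colPattern k N := by
  have hex : ∀ i, (∃ x : M, hasColor i x) ↔ ∃ x : N, hasColor i x := fun i =>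
    e.toEquiv.exists_congr fun x => (hasColor_map e i x).symm
  ext i j
  · exact hex i
  · refine e.toEquiv.exists_congr fun x => and_congr (hasColor_map e i x).symm ?_
    refine e.toEquiv.forall_congr fun y => ?_
    exact imp_congr (hasColor_map e i y).symm e.toEquiv.apply_eq_iff_eq.symm
  · refine and_congr (hex i) (and_congr (hex j) ?_)
    refine e.toEquiv.forall_congr fun x => e.toEquiv.forall_congr fun y => ?_
    exact imp_congr (hasColor_map e i x).symm
      (imp_congr (hasColor_map e j y).symm (colLt_map e x y).symm)

/-- Two colors lie in the same dense block. -/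
def ColorPattern.Interleaved {α : Type*} (p : ColorPattern α) (i j : α) : Prop :=
  p.used i ∧ p.used j ∧ ¬ p.single i ∧ ¬ p.single j ∧ ¬ p.before i j ∧ ¬ p.before j i

theorem ColorPattern.Interleaved.symm {α : Type*} {p : ColorPattern α} {i j : α}
    (h : p.Interleaved i j) : p.Interleaved j i :=
  ⟨h.2.1, h.1, h.2.2.2.1, h.2.2.1, h.2.2.2.2.2, h.2.2.2.2.1⟩

namespace IsColoredLinearOrder

theorem lt_irrefl (hM : IsColoredLinearOrder k M) (x : M) : ¬ colLt k x x := hM.linear.irrefl x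

theorem lt_trans (hM : IsColoredLinearOrder k M)
    {x y z : M} : colLt k x y → colLt k y z → colLt k x z :=
  hM.linear.trans x y z

theorem lt_trichotomy (hM : IsColoredLinearOrder k M)
    (x y : M) : colLt k x y ∨ x = y ∨ colLt k y x :=
  have : IsStrictTotalOrder M (colLt k) := hM.linear
  trichotomous_of (colLt k) x y

theorem color_unique (hM : IsColoredLinearOrder k M)
    {x : M} {i j : Fin k} (hi : hasColor i x) (hj : hasColor j x) : i = j :=
  (hM.color x).unique hi hj

theorem exists_hasColor (hM : IsColoredLinearOrder k M)
    (x : M) : ∃ i : Fin k, hasColor i x := (hM.color x).exists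

end IsColoredLinearOrder

variable (k M) in
/-- A colored linear ordering in which every color of a dense block is dense in it, and
unbounded in both directions. -/
structure IsGenericColored : Prop extends IsColoredLinearOrder k M where
  weakOrder : (colPattern k M).IsWeakOrder
  exists_gt : ∀ (i j : Fin k) (x : M), (colPattern k M).Interleaved i j → hasColor j x →
    ∃ z, hasColor i z ∧ colLt k x z
  exists_lt : ∀ (i j : Fin k) (x : M), (colPattern k M).Interleaved i j → hasColor j x →
    ∃ z, hasColor i z ∧ colLt k z x
  exists_between : ∀ (i j l : Fin k) (x y : M), (colPattern k M).Interleaved i j →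
    (colPattern k M).Interleaved i l → hasColor j x → hasColor l y → colLt k x y →
    ∃ z, hasColor i z ∧ colLt k x z ∧ colLt k z y

section Homogeneous

/-- In a homogeneous colored ordering, partial isomorphisms between finite sets extend. -/
theorem exists_automorphism (hM : IsColoredLinearOrder k M)
    (hom : (coloredOrderLang k).IsUltrahomogeneous M)
    {s : Set M} (hs : s.Finite) (f : M → M)
    (hlt : ∀ x ∈ s, ∀ y ∈ s, colLt k (f x) (f y) ↔ colLt k x y)
    (hcol : ∀ (i : Fin k), ∀ x ∈ s, hasColor i (f x) ↔ hasColor i x) :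
    ∃ g : M ≃[coloredOrderLang k] M, ∀ x ∈ s, g x = f x := by
  let S := Substructure.closure (coloredOrderLang k) s
  have hS : ∀ x, x ∈ S ↔ x ∈ s := fun x =>
    Substructure.mem_closure_iff_of_isRelational _ s x
  let F : S ↪[coloredOrderLang k] M :=
    { toFun := fun x => f x
      inj' := by
        rintro ⟨x, hx⟩ ⟨y, hy⟩ h
        rw [hS] at hx hy
        have h' : f x = f y := h
        rcases hM.lt_trichotomy x y with hxy | hxy | hxy
        · rw [← hlt x hx y hy, h'] at hxy
          exact absurd hxy (hM.lt_irrefl _)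
        · exact Subtype.ext hxy
        · rw [← hlt y hy x hx, h'] at hxy
          exact absurd hxy (hM.lt_irrefl _)
      map_fun' := fun F => F.elim
      map_rel' := colored_relMap_iff (fun x : S => f x)
        (fun x y => (hlt x ((hS x).1 x.2) y ((hS y).1 y.2)).trans (colLt_coe S x y))
        fun i x => (hcol i x ((hS x).1 x.2)).trans (hasColor_coe S i x) }
  obtain ⟨g, hg⟩ := hom S (Substructure.fg_closure hs) F
  refine ⟨g, fun x hx => ?_⟩
  exact (DFunLike.congr_fun hg ⟨x, (hS x).2 hx⟩).symm

theorem exists_automorphism_point (hM : IsColoredLinearOrder k M)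
    (hom : (coloredOrderLang k).IsUltrahomogeneous M)
    {i : Fin k} {x y : M} (hx : hasColor i x) (hy : hasColor i y) :
    ∃ g : M ≃[coloredOrderLang k] M, g x = y := by
  obtain ⟨g, hg⟩ := exists_automorphism hM hom (Set.finite_singleton x) (fun _ => y)
    (by
      rintro _ rfl _ rfl
      exact iff_of_false (hM.lt_irrefl _) (hM.lt_irrefl _))
    (by
      rintro j _ rfl
      exact ⟨fun h => hM.color_unique hy h ▸ hx, fun h => hM.color_unique hx h ▸ hy⟩)
  exact ⟨g, hg x rfl⟩

theorem exists_automorphism_pair (hM : IsColoredLinearOrder k M)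
    (hom : (coloredOrderLang k).IsUltrahomogeneous M)
    {i j : Fin k} {x y x' y' : M} (hx : hasColor i x)
    (hx' : hasColor i x') (hy : hasColor j y) (hy' : hasColor j y') (h : colLt k x y)
    (h' : colLt k x' y') : ∃ g : M ≃[coloredOrderLang k] M, g x = x' ∧ g y = y' := by
  classical
  have hne : y ≠ x := by
    rintro rfl
    exact hM.lt_irrefl _ h
  have hyx : ¬ colLt k y x := fun h1 => hM.lt_irrefl _ (hM.lt_trans h h1)
  have hyx' : ¬ colLt k y' x' := fun h1 => hM.lt_irrefl _ (hM.lt_trans h' h1)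
  obtain ⟨g, hg⟩ := exists_automorphism hM hom (Set.toFinite {x, y})
    (fun z => if z = x then x' else y')
    (by
      rintro _ (rfl | rfl) _ (rfl | rfl) <;>
        simp [hne, h, h', hyx, hyx', hM.lt_irrefl])
    (by
      rintro l _ (rfl | rfl)
      · rw [if_pos rfl]
        exact ⟨fun h => hM.color_unique hx' h ▸ hx, fun h => hM.color_unique hx h ▸ hx'⟩
      · rw [if_neg hne]
        exact ⟨fun h => hM.color_unique hy' h ▸ hy, fun h => hM.color_unique hy h ▸ hy'⟩)
  exact ⟨g, by simpa using hg x (by simp), by simpa [hne] using hg y (by simp)⟩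

theorem exists_lt_of_interleaved (hM : IsColoredLinearOrder k M)
    {i j : Fin k} (h : (colPattern k M).Interleaved i j) :
    ∃ a b : M, hasColor i a ∧ hasColor j b ∧ colLt k a b := by
  obtain ⟨hi, hj, hsi, -, -, hb⟩ := h
  by_cases hij : i = j
  · subst hij
    obtain ⟨x, hx⟩ := hi
    have : ∃ y : M, hasColor i y ∧ y ≠ x := by
      by_contra! hc
      exact hsi ⟨x, hx, hc⟩
    obtain ⟨y, hy, hne⟩ := this
    rcases hM.lt_trichotomy x y with h | h | h
    · exact ⟨x, y, hx, hy, h⟩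
    · exact absurd h.symm hne
    · exact ⟨y, x, hy, hx, h⟩
  · have : ∃ b a : M, hasColor j b ∧ hasColor i a ∧ ¬ colLt k b a := by
      by_contra! hc
      exact hb ⟨hj, hi, hc⟩
    obtain ⟨b, a, hjb, hia, hba⟩ := this
    rcases hM.lt_trichotomy b a with h | h | h
    · exact absurd h hba
    · subst h
      exact absurd (hM.color_unique hia hjb) hij
    · exact ⟨a, b, hia, hjb, h⟩

/-- Automorphisms act transitively on each color. For `weak`, two witnesses of color l are moved to
the same point, which then puts a point of color j at or below one of color i. For
`single_comparable`, automorphisms fix the only point of color i, so color j lies on one side of it.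
-/
theorem colPattern_isWeakOrder (hM : IsColoredLinearOrder k M)
    (hom : (coloredOrderLang k).IsUltrahomogeneous M) : (colPattern k M).IsWeakOrder where
  used_of_single := fun i ⟨x, hx, _⟩ => ⟨x, hx⟩
  used_left := fun i j h => h.1
  used_right := fun i j h => h.2.1
  irrefl := fun i ⟨⟨x, hx⟩, _, h⟩ => hM.lt_irrefl x (h x x hx hx)
  trans := fun i j l ⟨hi, ⟨y, hy⟩, h⟩ ⟨_, hl, h'⟩ =>
    ⟨hi, hl, fun x z hx hz => hM.lt_trans (h x y hx hy) (h' y z hy hz)⟩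
  weak := by
    rintro i j l ⟨hi, hj, h⟩ hl
    by_contra! hc
    have h1 : ∃ a c : M, hasColor i a ∧ hasColor l c ∧ ¬ colLt k a c := by
      by_contra! hc'
      exact hc.1 ⟨hi, hl, hc'⟩
    have h2 : ∃ c b : M, hasColor l c ∧ hasColor j b ∧ ¬ colLt k c b := by
      by_contra! hc'
      exact hc.2 ⟨hl, hj, hc'⟩
    obtain ⟨a, c, ha, hc, hac⟩ := h1
    obtain ⟨c', b, hc', hb, hcb⟩ := h2
    obtain ⟨g, hg⟩ := exists_automorphism_point hM hom hc' hc
    have hgb : ¬ colLt k c (g b) := by rwa [← hg, colLt_map]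
    have hagb : colLt k a (g b) := h a (g b) ha ((hasColor_map g j b).2 hb)
    rcases hM.lt_trichotomy a c with h3 | rfl | h3
    · exact hac h3
    · exact hgb hagb
    · exact hgb (hM.lt_trans h3 hagb)
  single_comparable := by
    rintro i j ⟨x, hx, hxu⟩ hj hji
    by_contra! hc
    have h1 : ∃ y : M, hasColor j y ∧ ¬ colLt k x y := by
      by_contra! hc'
      exact hc.1 ⟨⟨x, hx⟩, hj, fun x' y hx' hy => by rw [hxu x' hx']; exact hc' y hy⟩
    have h2 : ∃ y : M, hasColor j y ∧ ¬ colLt k y x := by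
      by_contra! hc'
      exact hc.2 ⟨hj, ⟨x, hx⟩, fun y x' hy hx' => by rw [hxu x' hx']; exact hc' y hy⟩
    obtain ⟨y, hy, hxy⟩ := h1
    obtain ⟨y', hy', hxy'⟩ := h2
    obtain ⟨g, hg⟩ := exists_automorphism_point hM hom hy hy'
    have hgx : g x = x := hxu _ ((hasColor_map g i x).2 hx)
    rcases hM.lt_trichotomy x y with h3 | rfl | h3
    · exact hxy h3
    · exact hji (hM.color_unique hy hx)
    · rw [← colLt_map g, hg, hgx] at h3
      exact hxy' h3

/-- One pair of points in the required order can be moved to any prescribed point. For density, x <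
z < w is built with the right colors, and then (x, w) is moved to (x, y). -/
theorem isGenericColored (hM : IsColoredLinearOrder k M)
    (hom : (coloredOrderLang k).IsUltrahomogeneous M) : IsGenericColored k M := by
  have hgt : ∀ (i j : Fin k) (x : M), (colPattern k M).Interleaved i j → hasColor j x →
      ∃ z, hasColor i z ∧ colLt k x z := by
    intro i j x hij hx
    obtain ⟨a, b, ha, hb, hab⟩ := exists_lt_of_interleaved hM hij.symm
    obtain ⟨g, hg⟩ := exists_automorphism_point hM hom ha hx
    exact ⟨g b, (hasColor_map g i b).2 hb, by rwa [← hg, colLt_map]⟩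
  refine ⟨hM, colPattern_isWeakOrder hM hom, hgt, ?_, ?_⟩
  · intro i j x hij hx
    obtain ⟨a, b, ha, hb, hab⟩ := exists_lt_of_interleaved hM hij
    obtain ⟨g, hg⟩ := exists_automorphism_point hM hom hb hx
    exact ⟨g a, (hasColor_map g i a).2 ha, by rwa [← hg, colLt_map]⟩
  · intro i j l x y hij hil hx hy hxy
    obtain ⟨z, hz, hxz⟩ := hgt i j x hij hx
    obtain ⟨w, hw, hzw⟩ := hgt l i z hil.symm hz
    obtain ⟨g, hgx, hgw⟩ := exists_automorphism_pair hM hom hx hx hw hy (hM.lt_trans hxz hzw) hxy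
    exact ⟨g z, (hasColor_map g i z).2 hz, by rwa [← hgx, colLt_map], by rwa [← hgw, colLt_map]⟩

end Homogeneous

/-! ### Back-and-forth: the pattern determines the ordering -/

namespace IsGenericColored

/-- In a dense block, a point of a given color can be found in any finite cut. -/
theorem exists_between_finite (hN : IsGenericColored k N) {i : Fin k}
    (hi : (colPattern k N).used i) {A B : Set N} (hA : A.Finite) (hB : B.Finite)
    (hAi : ∀ a ∈ A, ∃ j, hasColor j a ∧ (colPattern k N).Interleaved i j)
    (hBi : ∀ b ∈ B, ∃ j, hasColor j b ∧ (colPattern k N).Interleaved i j)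
    (hAB : ∀ a ∈ A, ∀ b ∈ B, colLt k a b) :
    ∃ n, hasColor i n ∧ (∀ a ∈ A, colLt k a n) ∧ ∀ b ∈ B, colLt k n b := by
  classical
  have : IsStrictTotalOrder N (colLt k) := hN.linear
  let : LinearOrder N := linearOrderOfSTO (colLt k)
  have hmax : A.Nonempty → ∃ a ∈ A, ∀ n, colLt k a n → ∀ a' ∈ A, colLt k a' n := by
    intro hne
    obtain ⟨a, ha, hmax⟩ := Set.exists_max_image A id hA hne
    refine ⟨a, ha, fun n han a' ha' => ?_⟩
    obtain rfl | h : a' = a ∨ colLt k a' a := hmax a' ha'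
    · exact han
    · exact hN.lt_trans h han
  have hmin : B.Nonempty → ∃ b ∈ B, ∀ n, colLt k n b → ∀ b' ∈ B, colLt k n b' := by
    intro hne
    obtain ⟨b, hb, hmin⟩ := Set.exists_min_image B id hB hne
    refine ⟨b, hb, fun n hnb b' hb' => ?_⟩
    obtain rfl | h : b = b' ∨ colLt k b b' := hmin b' hb'
    · exact hnb
    · exact hN.lt_trans hnb h
  rcases A.eq_empty_or_nonempty with rfl | hAne <;> rcases B.eq_empty_or_nonempty with rfl | hBne
  · obtain ⟨n, hn⟩ := hi
    exact ⟨n, hn, by simp, by simp⟩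
  · obtain ⟨b, hb, hbmin⟩ := hmin hBne
    obtain ⟨j, hj, hij⟩ := hBi b hb
    obtain ⟨n, hn, hnb⟩ := hN.exists_lt i j b hij hj
    exact ⟨n, hn, by simp, hbmin n hnb⟩
  · obtain ⟨a, ha, hamax⟩ := hmax hAne
    obtain ⟨j, hj, hij⟩ := hAi a ha
    obtain ⟨n, hn, han⟩ := hN.exists_gt i j a hij hj
    exact ⟨n, hn, hamax n han, by simp⟩
  · obtain ⟨a, ha, hamax⟩ := hmax hAne
    obtain ⟨b, hb, hbmin⟩ := hmin hBne
    obtain ⟨j, hj, hij⟩ := hAi a ha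
    obtain ⟨l, hl, hil⟩ := hBi b hb
    obtain ⟨n, hn, han, hnb⟩ := hN.exists_between i j l a b hij hil hj hl (hAB a ha b hb)
    exact ⟨n, hn, hamax n han, hbmin n hnb⟩

/-- Points of other blocks impose no constraint, since `before` already settles their position. In a
singleton block the image is forced; in a dense block only the finite cut made by the points `T` of
the same block matters. -/
theorem exists_extension (hM : IsGenericColored k M) (hN : IsGenericColored k N)
    (h : colPattern k M = colPattern k N) {S : Set M} (hS : S.Finite) (f : M → N)
    (hlt : ∀ x ∈ S, ∀ y ∈ S, colLt k (f x) (f y) ↔ colLt k x y)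
    (hcol : ∀ i : Fin k, ∀ x ∈ S, hasColor i (f x) ↔ hasColor i x) {m : M} (hm : m ∉ S) :
    ∃ n : N, (∀ i : Fin k, hasColor i n ↔ hasColor i m) ∧
      ∀ x ∈ S, (colLt k (f x) n ↔ colLt k x m) ∧ (colLt k n (f x) ↔ colLt k m x) := by
  obtain ⟨i, hi⟩ := hM.exists_hasColor m
  have hcol_iff : ∀ n : N, hasColor i n → ∀ j : Fin k, hasColor j n ↔ hasColor j m :=
    fun n hn j => ⟨fun hj => hN.color_unique hn hj ▸ hi, fun hj => hM.color_unique hi hj ▸ hn⟩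
  have hused : (colPattern k N).used i := h ▸ ⟨m, hi⟩
  have of_lt : ∀ x n, colLt k (f x) n → colLt k x m →
      (colLt k (f x) n ↔ colLt k x m) ∧ (colLt k n (f x) ↔ colLt k m x) := fun x n h1 h2 =>
    ⟨iff_of_true h1 h2, iff_of_false (fun h3 => hN.lt_irrefl _ (hN.lt_trans h1 h3))
      fun h3 => hM.lt_irrefl _ (hM.lt_trans h2 h3)⟩
  have of_gt : ∀ x n, colLt k n (f x) → colLt k m x →
      (colLt k (f x) n ↔ colLt k x m) ∧ (colLt k n (f x) ↔ colLt k m x) := fun x n h1 h2 =>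
    ⟨iff_of_false (fun h3 => hN.lt_irrefl _ (hN.lt_trans h1 h3))
      fun h3 => hM.lt_irrefl _ (hM.lt_trans h2 h3), iff_of_true h1 h2⟩
  have of_before : ∀ x ∈ S, ∀ j, hasColor j x → ∀ n, hasColor i n →
      ((colPattern k M).before i j ∨ (colPattern k M).before j i) →
      (colLt k (f x) n ↔ colLt k x m) ∧ (colLt k n (f x) ↔ colLt k m x) := by
    rintro x hx j hj n hn (hb | hb)
    · exact of_gt x n ((h ▸ hb : (colPattern k N).before i j).2.2 n (f x) hn ((hcol j x hx).2 hj))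
        (hb.2.2 m x hi hj)
    · exact of_lt x n ((h ▸ hb : (colPattern k N).before j i).2.2 (f x) n ((hcol j x hx).2 hj) hn)
        (hb.2.2 x m hj hi)
  by_cases hs : (colPattern k M).single i
  · obtain ⟨n, hn⟩ := hused
    refine ⟨n, hcol_iff n hn, fun x hx => ?_⟩
    obtain ⟨j, hj⟩ := hM.exists_hasColor x
    refine of_before x hx j hj n hn (hM.weakOrder.single_comparable i j hs ⟨x, hj⟩ ?_)
    rintro rfl
    obtain ⟨y, -, hy⟩ := hs
    exact hm ((hy m hi).trans (hy x hj).symm ▸ hx)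
  · let T : Set M := {x ∈ S | ∃ j, hasColor j x ∧ (colPattern k M).Interleaved i j}
    have hT : ∀ x ∈ T, ∃ j, hasColor j (f x) ∧ (colPattern k N).Interleaved i j := by
      rintro x ⟨hx, j, hj, hij⟩
      exact ⟨j, (hcol j x hx).2 hj, h ▸ hij⟩
    have hTfin : T.Finite := hS.subset fun x hx => hx.1
    obtain ⟨n, hn, hA, hB⟩ := hN.exists_between_finite hused
      (A := f '' {x ∈ T | colLt k x m}) (B := f '' {x ∈ T | colLt k m x})
      ((hTfin.subset fun x hx => hx.1).image f) ((hTfin.subset fun x hx => hx.1).image f)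
      (by rintro _ ⟨x, hx, rfl⟩; exact hT x hx.1)
      (by rintro _ ⟨x, hx, rfl⟩; exact hT x hx.1)
      (by
        rintro _ ⟨x, hx, rfl⟩ _ ⟨y, hy, rfl⟩
        exact (hlt x hx.1.1 y hy.1.1).2 (hM.lt_trans hx.2 hy.2))
    refine ⟨n, hcol_iff n hn, fun x hx => ?_⟩
    obtain ⟨j, hj⟩ := hM.exists_hasColor x
    by_cases hb : (colPattern k M).before i j ∨ (colPattern k M).before j i
    · exact of_before x hx j hj n hn hb
    · push Not at hb
      have hsj : ¬ (colPattern k M).single j := fun hsj => by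
        rcases eq_or_ne i j with rfl | hij
        · exact hs hsj
        · rcases hM.weakOrder.single_comparable j i hsj ⟨m, hi⟩ hij with h' | h'
          · exact hb.2 h'
          · exact hb.1 h'
      have hxT : x ∈ T := ⟨hx, j, hj, ⟨m, hi⟩, ⟨x, hj⟩, hs, hsj, hb.1, hb.2⟩
      rcases hM.lt_trichotomy x m with h' | rfl | h'
      · exact of_lt x n (hA _ ⟨x, ⟨hxT, h'⟩, rfl⟩) h'
      · exact absurd hx hm
      · exact of_gt x n (hB _ ⟨x, ⟨hxT, h'⟩, rfl⟩) h'

theorem isExtensionPair (hM : IsGenericColored k M) (hN : IsGenericColored k N)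
    (h : colPattern k M = colPattern k N) : (coloredOrderLang k).IsExtensionPair M N := by
  classical
  rw [isExtensionPair_iff_exists_embedding_closure_singleton_sup]
  intro S hS f m
  have hSfin : (S : Set M).Finite := Set.finite_coe_iff.1 hS.finite
  have hmem : ∀ x, x ∈ Substructure.closure (coloredOrderLang k) {m} ⊔ S ↔ x = m ∨ x ∈ S := by
    intro x
    rw [← Substructure.closure_eq S, ← Substructure.closure_union,
      Substructure.mem_closure_iff_of_isRelational, Substructure.closure_eq]
    rfl
  by_cases hm : m ∈ S
  · have hle : Substructure.closure (coloredOrderLang k) {m} ⊔ S ≤ S := by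
      intro x hx
      rcases (hmem x).1 hx with rfl | hx
      · exact hm
      · exact hx
    exact ⟨f.comp (Substructure.inclusion hle), by ext x; rfl⟩
  -- A default value for extending `f` to all of `M`; only values on `S` are ever used.
  obtain ⟨n₀, -⟩ : ∃ n : N, True := by
    obtain ⟨i, hi⟩ := hM.exists_hasColor m
    obtain ⟨n, -⟩ : (colPattern k N).used i := h ▸ ⟨m, hi⟩
    exact ⟨n, trivial⟩
  let F : M → N := fun x => if hx : x ∈ S then f ⟨x, hx⟩ else n₀
  have hF : ∀ x (hx : x ∈ S), F x = f ⟨x, hx⟩ := fun x hx => dif_pos hx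
  have hFlt : ∀ x ∈ S, ∀ y ∈ S, colLt k (F x) (F y) ↔ colLt k x y := fun x hx y hy => by
    rw [hF x hx, hF y hy, colLt_map, ← colLt_coe]
  have hFcol : ∀ i : Fin k, ∀ x ∈ S, hasColor i (F x) ↔ hasColor i x := fun i x hx => by
    rw [hF x hx, hasColor_map, ← hasColor_coe]
  obtain ⟨n, hn, hext⟩ := hM.exists_extension hN h hSfin F hFlt hFcol hm
  let G : M → N := fun x => if x = m then n else F x
  have hGm : G m = n := if_pos rfl
  have hGS : ∀ x ∈ S, G x = F x := fun x hx => if_neg (by rintro rfl; exact hm hx)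
  let S' := Substructure.closure (coloredOrderLang k) {m} ⊔ S
  have hGlt : ∀ x ∈ S', ∀ y ∈ S', colLt k (G x) (G y) ↔ colLt k x y := by
    intro x hx y hy
    rcases (hmem x).1 hx with rfl | hxS <;> rcases (hmem y).1 hy with rfl | hyS
    · exact iff_of_false (hN.lt_irrefl _) (hM.lt_irrefl _)
    · rw [hGm, hGS y hyS]
      exact (hext y hyS).2
    · rw [hGm, hGS x hxS]
      exact (hext x hxS).1
    · rw [hGS x hxS, hGS y hyS]
      exact hFlt x hxS y hyS
  have hGcol : ∀ i : Fin k, ∀ x ∈ S', hasColor i (G x) ↔ hasColor i x := by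
    intro i x hx
    rcases (hmem x).1 hx with rfl | hxS
    · rw [hGm]
      exact hn i
    · rw [hGS x hxS]
      exact hFcol i x hxS
  refine ⟨{ toFun := fun x => G x, inj' := ?_, map_fun' := fun F => F.elim,
            map_rel' := colored_relMap_iff (fun x : S' => G x)
              (fun x y => (hGlt x x.2 y y.2).trans (colLt_coe S' x y))
              fun i x => (hGcol i x x.2).trans (hasColor_coe S' i x) }, ?_⟩
  · rintro ⟨x, hx⟩ ⟨y, hy⟩ hxy
    have hxy' : G x = G y := hxy
    rcases hM.lt_trichotomy x y with h' | h' | h'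
    · rw [← hGlt x hx y hy, hxy'] at h'
      exact absurd h' (hN.lt_irrefl _)
    · exact Subtype.ext h'
    · rw [← hGlt y hy x hx, hxy'] at h'
      exact absurd h' (hN.lt_irrefl _)
  · ext x
    change f x = G x
    rw [hGS x x.2, hF x x.2]

theorem nonempty_equiv [Countable M] [Countable N] (hM : IsGenericColored k M)
    (hN : IsGenericColored k N) (h : colPattern k M = colPattern k N) :
    Nonempty (M ≃[coloredOrderLang k] N) := by
  obtain ⟨e, -⟩ := equiv_between_cg (L := coloredOrderLang k) Structure.cg_of_countable
    Structure.cg_of_countable default (hM.isExtensionPair hN h) (hN.isExtensionPair hM h.symm)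
  exact ⟨e⟩

theorem isUltrahomogeneous [Countable M] (hM : IsGenericColored k M) :
    (coloredOrderLang k).IsUltrahomogeneous M :=
  (isUltrahomogeneous_iff_IsExtensionPair Structure.cg_of_countable).2 (hM.isExtensionPair hM rfl)

end IsGenericColored

end Colored

/-! ### Realizing every pattern by labelled rationals -/

/-- A map from the rationals to the natural numbers all of whose fibers are dense. -/
def denLabel (q : ℚ) : ℕ := (Nat.unpair (padicValNat 2 q.den)).1

theorem exists_denLabel_eq_between (n : ℕ) {a b : ℚ} (hab : a < b) :
    ∃ q, denLabel q = n ∧ a < q ∧ q < b := by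
  -- Fractions with odd numerator over 2^e are spaced 2/2^e apart. The second coordinate of e = pair
  -- n N does not affect the label, so it is free to make e large.
  obtain ⟨N, hN⟩ := exists_nat_gt (2 / (b - a))
  set e := Nat.pair n N with he
  have hNe : N < 2 ^ e := (Nat.right_le_pair n N).trans_lt Nat.lt_two_pow_self
  have hpos : (0 : ℚ) < 2 ^ e := by positivity
  have hgap : 2 < (b - a) * 2 ^ e := by
    have h1 : 2 / (b - a) < (2 : ℚ) ^ e := hN.trans (by exact_mod_cast hNe)
    rwa [div_lt_iff₀' (by linarith)] at h1
  obtain ⟨c, hc1, hc2⟩ : ∃ c : ℤ, a * 2 ^ e < 2 * c + 1 ∧ (2 * c + 1 : ℚ) < b * 2 ^ e := by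
    refine ⟨⌊(a * 2 ^ e - 1) / 2⌋ + 1, ?_, ?_⟩
    · have := Int.lt_floor_add_one ((a * 2 ^ e - 1) / 2)
      push_cast
      linarith
    · have := Int.floor_le ((a * 2 ^ e - 1) / 2)
      push_cast
      linarith
  refine ⟨(2 * c + 1 : ℚ) / 2 ^ e, ?_, (lt_div_iff₀ hpos).2 hc1, (div_lt_iff₀ hpos).2 hc2⟩
  have hden : ((2 * c + 1 : ℚ) / 2 ^ e).den = 2 ^ e := by
    have h := Rat.den_div_eq_of_coprime (a := 2 * c + 1) (b := 2 ^ e) (by positivity) (by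
      rw [Int.natAbs_pow]
      refine Nat.Coprime.pow_right _ ?_
      exact Nat.coprime_two_right.2 (Int.natAbs_odd.2 ⟨c, rfl⟩))
    push_cast at h
    exact Nat.cast_injective (R := ℤ) (h.trans (by push_cast; rfl))
  rw [denLabel, hden, padicValNat.prime_pow, he, Nat.unpair_pair]

theorem exists_denLabel_eq (n : ℕ) : ∃ q, denLabel q = n := by
  obtain ⟨q, hq, -⟩ := exists_denLabel_eq_between n (zero_lt_one' ℚ)
  exact ⟨q, hq⟩

section GenericOrder

variable {k : ℕ}

/-- The points of the standard homogeneous colored ordering with pattern `p`: rationals labelled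
by their color, where a color of a singleton block keeps only one rational. -/
def GenericOrder (p : ColorPattern (Fin k)) : Type :=
  {x : Fin k × ℚ // denLabel x.2 = x.1 ∧ p.used x.1 ∧
    (p.single x.1 → x.2 = (exists_denLabel_eq x.1).choose)}

instance (p : ColorPattern (Fin k)) : Countable (GenericOrder p) :=
  inferInstanceAs (Countable (Subtype _))

/-- Points of different blocks are ordered as their blocks, points of one block as rationals. -/
instance (p : ColorPattern (Fin k)) : (coloredOrderLang k).Structure (GenericOrder p) where
  funMap := fun F => F.elim
  RelMap := fun {n} (r : ColoredOrderRel k n) => match n, r with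
    | _, .lt => fun v => p.before (v 0).1.1 (v 1).1.1 ∨
        (¬ p.before (v 1).1.1 (v 0).1.1 ∧ (v 0).1.2 < (v 1).1.2)
    | _, .color i => fun v => (v 0).1.1 = i

namespace GenericOrder

variable {p : ColorPattern (Fin k)}

theorem colLt_iff (x y : GenericOrder p) : colLt k x y ↔
    p.before x.1.1 y.1.1 ∨ (¬ p.before y.1.1 x.1.1 ∧ x.1.2 < y.1.2) := Iff.rfl

theorem hasColor_iff (i : Fin k) (x : GenericOrder p) : hasColor i x ↔ x.1.1 = i := Iff.rfl

theorem exists_between {i : Fin k} (hu : p.used i) (hs : ¬ p.single i) {a b : ℚ} (hab : a < b) :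
    ∃ z : GenericOrder p, hasColor i z ∧ a < z.1.2 ∧ z.1.2 < b := by
  obtain ⟨q, hq, h⟩ := exists_denLabel_eq_between i hab
  exact ⟨⟨(i, q), hq, hu, fun h => absurd h hs⟩, rfl, h⟩

/-- Distinct points of one block have distinct rationals, because the rational determines the color
through `denLabel`. -/
theorem isColoredLinearOrder (hp : p.IsWeakOrder) : IsColoredLinearOrder k (GenericOrder p) := by
  obtain ⟨h1, h2, h3, h4, h5, h6, h7⟩ := hp
  refine ⟨{ trichotomous := ?_, irrefl := ?_, trans := ?_ }, fun x => ⟨x.1.1, rfl, fun j hj => ?_⟩⟩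
  · intro x y hxy hyx
    change ¬ colLt k x y at hxy
    change ¬ colLt k y x at hyx
    rw [colLt_iff] at hxy hyx
    push Not at hxy hyx
    have hq : x.1.2 = y.1.2 := le_antisymm (hyx.2 hxy.1) (hxy.2 hyx.1)
    have hi : x.1.1 = y.1.1 := Fin.ext (by rw [← x.2.1, ← y.2.1, hq])
    exact Subtype.ext (Prod.ext hi hq)
  · intro x hx
    change colLt k x x at hx
    rw [colLt_iff] at hx
    rcases hx with hx | hx
    · exact h4 _ hx
    · exact lt_irrefl _ hx.2
  · intro x y z hxy hyz
    change colLt k x y at hxy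
    change colLt k y z at hyz
    change colLt k x z
    rw [colLt_iff] at *
    have hx := x.2.2.1
    have hy := y.2.2.1
    have hz := z.2.2.1
    rcases hxy with hxy | ⟨hxy, hq⟩ <;> rcases hyz with hyz | ⟨hyz, hq'⟩
    · exact Or.inl (h5 _ _ _ hxy hyz)
    · exact Or.inl ((h6 _ _ _ hxy hz).resolve_right hyz)
    · exact Or.inl ((h6 _ _ _ hyz hx).resolve_left hxy)
    · exact Or.inr ⟨fun h => (h6 _ _ _ h hy).elim hyz hxy, hq.trans hq'⟩
  · exact (hj : x.1.1 = j).symm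

theorem colPattern_eq (hp : p.IsWeakOrder) : colPattern k (GenericOrder p) = p := by
  have hL := isColoredLinearOrder hp
  obtain ⟨h1, h2, h3, h4, h5, h6, h7⟩ := hp
  have hex : ∀ i, (∃ x : GenericOrder p, hasColor i x) ↔ p.used i := by
    intro i
    constructor
    · rintro ⟨x, rfl⟩
      exact x.2.2.1
    · intro hi
      exact ⟨⟨(i, (exists_denLabel_eq i).choose), (exists_denLabel_eq i).choose_spec, hi,
        fun _ => rfl⟩, rfl⟩
  ext i j
  · exact hex i
  · constructor
    · rintro ⟨x, hx, hxu⟩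
      have hi := (hex i).1 ⟨x, hx⟩
      by_contra hs
      obtain ⟨z, hz, hz', -⟩ := exists_between hi hs (lt_add_one x.1.2)
      rw [hxu z hz] at hz'
      exact lt_irrefl _ hz'
    · intro hs
      obtain ⟨x, hx⟩ := (hex i).2 (h1 i hs)
      refine ⟨x, hx, fun y hy => Subtype.ext (Prod.ext ((hy : y.1.1 = i).trans hx.symm) ?_)⟩
      obtain rfl := (hasColor_iff i x).1 hx
      have hyx : y.1.1 = x.1.1 := hy
      rw [x.2.2.2 hs, y.2.2.2 (by rwa [hyx])]
      simp only [hyx]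
  · constructor
    · rintro ⟨hi, hj, h⟩
      rw [hex] at hi hj
      by_contra hb
      have hji : ¬ p.before j i := by
        intro hji
        obtain ⟨x, hx⟩ := (hex i).2 hi
        obtain ⟨y, hy⟩ := (hex j).2 hj
        have := (colLt_iff x y).1 (h x y hx hy)
        rw [(hasColor_iff i x).1 hx, (hasColor_iff j y).1 hy] at this
        tauto
      by_cases hij : i = j
      · subst hij
        obtain ⟨x, hx⟩ := (hex i).2 hi
        exact hL.lt_irrefl x (h x x hx hx)
      · have hsi : ¬ p.single i := fun hs => (h7 i j hs hj (Ne.symm hij)).elim hb hji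
        have hsj : ¬ p.single j := fun hs => (h7 j i hs hi hij).elim hji hb
        -- Two dense colors in one block are not separated: a y in (0, 1) lies below an x in (1, 2).
        obtain ⟨y, hy, -, hy1⟩ := exists_between hj hsj (zero_lt_one' ℚ)
        obtain ⟨x, hx, hx1, -⟩ := exists_between hi hsi (show (1 : ℚ) < 2 by norm_num)
        have := (colLt_iff x y).1 (h x y hx hy)
        rw [(hasColor_iff i x).1 hx, (hasColor_iff j y).1 hy] at this
        rcases this with h' | h'
        · exact hb h'
        · exact lt_irrefl _ (h'.2.trans (hy1.trans hx1))
    · intro h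
      refine ⟨(hex i).2 (h2 i j h), (hex j).2 (h3 i j h), ?_⟩
      rintro x y rfl rfl
      exact Or.inl h

theorem isGenericColored (hp : p.IsWeakOrder) : IsGenericColored k (GenericOrder p) := by
  have hpat := colPattern_eq hp
  refine ⟨isColoredLinearOrder hp, by rwa [hpat], ?_, ?_, ?_⟩ <;> rw [hpat]
  · rintro i _ x ⟨hi, -, hs, -, hb, -⟩ rfl
    obtain ⟨z, hz, hz', -⟩ := exists_between hi hs (lt_add_one x.1.2)
    obtain rfl := (hasColor_iff i z).1 hz
    exact ⟨z, hz, Or.inr ⟨hb, hz'⟩⟩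
  · rintro i _ x ⟨hi, -, hs, -, -, hb⟩ rfl
    obtain ⟨z, hz, -, hz'⟩ := exists_between hi hs (sub_one_lt x.1.2)
    obtain rfl := (hasColor_iff i z).1 hz
    exact ⟨z, hz, Or.inr ⟨hb, hz'⟩⟩
  · rintro i _ _ x y ⟨hi, -, hs, -, hb, hb'⟩ ⟨-, -, -, -, hc, hc'⟩ rfl rfl hxy
    -- Color i is incomparable with both colors, so by weakness these share its block and x < y is
    -- decided by the rationals.
    have hq : x.1.2 < y.1.2 := by
      rcases (colLt_iff x y).1 hxy with h | h
      · exact ((hp.weak _ _ _ h hi).elim hb' hc).elim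
      · exact h.2
    obtain ⟨z, hz, hz1, hz2⟩ := exists_between hi hs hq
    obtain rfl := (hasColor_iff i z).1 hz
    exact ⟨z, hz, Or.inr ⟨hb, hz1⟩, Or.inr ⟨hc', hz2⟩⟩

end GenericOrder

theorem isoTypes_homogeneousColoredOrders (k : ℕ) :
    (isoTypes (homogeneousColoredOrders k)).Finite ∧ numHomogeneous k =
      {p : ColorPattern (Fin k) | p.IsWeakOrder}.ncard :=
  isoTypes_ncard_eq (fun M => colPattern k M) _
    (fun _ hM => colPattern_isWeakOrder hM.2.1 hM.2.2)
    (fun _ _ _ _ ⟨e⟩ => colPattern_congr e)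
    (fun _ hM _ hN h =>
      have := hM.1
      have := hN.1
      (_root_.isGenericColored hM.2.1 hM.2.2).nonempty_equiv
        (_root_.isGenericColored hN.2.1 hN.2.2) h)
    (fun p hp => ⟨⟨GenericOrder p, inferInstance⟩,
      ⟨inferInstanceAs (Countable (GenericOrder p)), GenericOrder.isColoredLinearOrder hp,
        (GenericOrder.isGenericColored hp).isUltrahomogeneous⟩, GenericOrder.colPattern_eq hp⟩)

theorem numHomogeneousAll_eq (k : ℕ) : numHomogeneousAll k =
    {p : ColorPattern (Fin k) | p.IsWeakOrder ∧ ∀ i, p.used i}.ncard :=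
  (isoTypes_ncard_eq (K := homogeneousAllColors k) (fun M => colPattern k M)
    {p : ColorPattern (Fin k) | p.IsWeakOrder ∧ ∀ i, p.used i}
    (fun _ hM => ⟨colPattern_isWeakOrder hM.1.2.1 hM.1.2.2, hM.2⟩)
    (fun _ _ _ _ ⟨e⟩ => colPattern_congr e)
    (fun _ hM _ hN h =>
      have := hM.1.1
      have := hN.1.1
      (_root_.isGenericColored hM.1.2.1 hM.1.2.2).nonempty_equiv
        (_root_.isGenericColored hN.1.2.1 hN.1.2.2) h)
    (fun p ⟨hp, hu⟩ => ⟨⟨GenericOrder p, inferInstance⟩,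
      ⟨⟨inferInstanceAs (Countable (GenericOrder p)), GenericOrder.isColoredLinearOrder hp,
        (GenericOrder.isGenericColored hp).isUltrahomogeneous⟩, fun i => by
          have := hu i
          rwa [← GenericOrder.colPattern_eq hp] at this⟩, GenericOrder.colPattern_eq hp⟩)).2

end GenericOrder

/-! ### The main theorem -/

theorem numHomogeneous_eq (k : ℕ) : numHomogeneous k = ColorPattern.totalCount k :=
  (isoTypes_homogeneousColoredOrders k).2.trans (ColorPattern.card_isWeakOrder k)

theorem mainTheorem7 :
    -- for each `k` there are finitely many isomorphism types, as many as there are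
    -- multicolored orderings
    (∀ k : ℕ, (isoTypes (homogeneousColoredOrders k)).Finite ∧
      (isoTypes (multiColoredOrders k)).Finite ∧
      numHomogeneous k = (isoTypes (multiColoredOrders k)).ncard) ∧
    -- the recursion
    (∃ J : ℕ → ℕ, J 0 = 1 ∧
      (∀ k : ℕ, J (k + 1) = 2 * (k + 1) * J k +
        ∑ i ∈ Finset.Icc 2 (k + 1), (k + 1).choose i * J (k + 1 - i)) ∧
      ∀ k : ℕ, numHomogeneous k = ∑ i ∈ Finset.range (k + 1), J i * k.choose i) ∧
    -- the exponential generating function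
    (PowerSeries.mk fun k : ℕ => (numHomogeneous k : ℝ) / (k ! : ℝ)) =
      PowerSeries.exp ℝ * (2 - PowerSeries.X - PowerSeries.exp ℝ)⁻¹ ∧
    -- `R` is the residue at `Z` of the meromorphic function `e^z / (2 - z - e^z)`
    Tendsto (fun z : ℂ => (z - (dominantPole : ℂ)) *
        (Complex.exp z / (2 - z - Complex.exp z)))
      (𝓝[≠] (dominantPole : ℂ)) (𝓝 (poleResidue : ℂ)) ∧
    -- the asymptotics
    Asymptotics.IsEquivalent atTop (fun k : ℕ => (numHomogeneous k : ℝ))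
      (fun k : ℕ => -((k ! : ℝ) * poleResidue * (1 / dominantPole) ^ (k + 1))) ∧
    -- the limiting proportion of those that use all `k` colors
    Tendsto (fun k : ℕ => (numHomogeneousAll k : ℝ) / (numHomogeneous k : ℝ)) atTop
      (𝓝 (1 / lambertW (Real.exp 2))) ∧
    -- the numerical values
    |dominantPole - 0.442854| < 1e-6 ∧ |poleResidue + 0.6089389| < 1e-7 ∧
    |1 / lambertW (Real.exp 2) - 0.6422007| < 1e-7 := by
  simp only [numHomogeneous_eq,
    fun k => (numHomogeneousAll_eq k).trans (ColorPattern.card_isWeakOrder_all k)]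
  refine ⟨fun k => ⟨(isoTypes_homogeneousColoredOrders k).1, (isoTypes_multiColoredOrders k).1, ?_⟩,
    ⟨ColorPattern.patternCount, ColorPattern.patternCount_zero,
      ColorPattern.patternCount_succ_eq_sum_Icc, fun k => rfl⟩,
    ColorPattern.mk_totalCount_eq_exp_mul_inv, tendsto_residue,
    ColorPattern.isEquivalent_totalCount, ColorPattern.tendsto_patternCount_div_totalCount,
    abs_dominantPole_sub_lt, abs_poleResidue_add_lt, abs_inv_lambertW_sub_lt⟩
  rw [(isoTypes_multiColoredOrders k).2, ColorPattern.card_isWeakOrder]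
  rfl
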